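/- For $n\ge 1$ write $z=(z_1,\dots,z_n)$, $\Delta=\sum_{i=1}^n \partial^2/\partial z_i^2$ and $\nabla P=(\partial P/\partial z_1,\dots,\partial P/\partial z_n)$. The order $o(P)$ of a polynomial or power series is the least degree in $z$ of a monomial occurring in it ($\infty$ if $P=0$). A polynomial $P\in\mathbb C[z]$ is called Hessian nilpotent (HN) if its Hessian matrix $\left(\frac{\partial^2 P}{\partial z_i\partial z_j}\right)$ is nilpotent. The following statements are equivalent. 1. For every $n\ge1$ and every homogeneous HN polynomial $P\in\mathbb C[z_1,\dots,z_n]$ of degree $4$, one has $\Delta^kP^{k+1}=0$ for all sufficiently large $k$. 2. For every $n\ge1$, every $d\ge2$ and every homogeneous HN polynomial $P\in\mathbb C[z_1,\dots,z_n]$ of degree $d$, one has $\Delta^kP^{k+1}=0$ for all sufficiently large $k$. 3. (Vanishing conjecture) For every $n\ge1$ and every HN polynomial $P\in\mathbb C[z_1,\dots,z_n]$, not necessarily homogeneous, of degree at least $2$, one has $\Delta^kP^{k+1}=0$ for all sufficiently large $k$. 4. (Jacobian conjecture) For every $n\ge1$ and every polynomial map $F(z)=z-H(z)$ from $\mathbb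 C^n$ to $\mathbb C^n$ such that every component of $H$ has order at least $2$ and the Jacobian determinant of $F$ is identically $1$, the inverse of $F$ is a polynomial map, that is, there is a polynomial map $G$ with $F\circ G=G\circ F=z$. The four statements are equivalent as well if in (1), (2) and (3) the conclusion "$\Delta^kP^{k+1}=0$ for all sufficiently large $k$" is replaced by "the deformed inversion pair of $P$ is a polynomial in $z$ and $t$", where in (3) only polynomials $P$ with $o(P)\ge2$ are then considered. Here the deformed inversion pair of $P$ with $o(P)\ge 2$ is the unique power series $Q_t(z)\in\mathbb C[[z,t]]$, of order at least $2$ in $z$, such that $z+t\nabla Q_t(z)$ is the inverse of $z-t\nabla P(z)$. -/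

import Mathlib

namespace HNPoly

open MvPolynomial

/-- A polynomial map of affine `n`-space over `R`, given by its `n` coordinate polynomials. -/
abbrev PolyMap (n : ℕ) (R : Type*) [CommRing R] := Fin n → MvPolynomial (Fin n) R

/-- The composition `F ∘ G` of polynomial maps: substitute `G` into every coordinate of `F`. -/
noncomputable def PolyMap.comp {n : ℕ} {R : Type*} [CommRing R] (F G : PolyMap n R) :
    PolyMap n R :=
  fun i => bind₁ G (F i)

/-- `F` and `G` are inverse to each other as polynomial maps: `F ∘ G = z` and `G ∘ F = z`. -/
def AreInverse {n : ℕ} {R : Type*} [CommRing R] (F G : PolyMap n R) : Prop :=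
  F.comp G = X ∧ G.comp F = X

/-- The Jacobian matrix `(∂ F_i / ∂ z_j)`. -/
noncomputable def jacobianMatrix {n : ℕ} {R : Type*} [CommRing R] (F : PolyMap n R) :
    Matrix (Fin n) (Fin n) (MvPolynomial (Fin n) R) :=
  Matrix.of fun i j => pderiv j (F i)

/-- The order `o(P)`: the least degree in `z` of a monomial that occurs in `P` (`⊤` if `P = 0`). -/
noncomputable def polyOrder {n : ℕ} {R : Type*} [CommRing R] (P : MvPolynomial (Fin n) R) : ℕ∞ :=
  (P : MvPowerSeries (Fin n) R).order

/-- The gradient `∇P`. -/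
noncomputable def gradient {n : ℕ} {R : Type*} [CommRing R] (P : MvPolynomial (Fin n) R) :
    PolyMap n R :=
  fun i => pderiv i P

/-- The Hessian matrix `(∂² P / ∂ z_i ∂ z_j)`. -/
noncomputable def hessian {n : ℕ} {R : Type*} [CommRing R] (P : MvPolynomial (Fin n) R) :
    Matrix (Fin n) (Fin n) (MvPolynomial (Fin n) R) :=
  Matrix.of fun i j => pderiv i (pderiv j P)

/-- The Laplace operator `Δ = ∑ ∂² / ∂ z_i²`. -/
noncomputable def laplacian {n : ℕ} {R : Type*} [CommRing R] (P : MvPolynomial (Fin n) R) :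
    MvPolynomial (Fin n) R :=
  ∑ i, pderiv i (pderiv i P)

/-- `P` is Hessian nilpotent (HN). -/
def IsHN {n : ℕ} (P : MvPolynomial (Fin n) ℂ) : Prop :=
  IsNilpotent (hessian P)

/-- `Δ^k P^(k+1) = 0` for all sufficiently large `k`. -/
def EventuallyVanishes {n : ℕ} (P : MvPolynomial (Fin n) ℂ) : Prop :=
  ∃ N : ℕ, ∀ k : ℕ, N ≤ k → laplacian^[k] (P ^ (k + 1)) = 0

/-- The deformed inversion pair of `P` (where `o(P) ≥ 2`) is a polynomial in `z` and `t`.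
The deformed inversion pair is the unique power series `Q` in `z` and `t`, of order at least `2`
in `z`, such that `z + t ∇Q` is the inverse of `z - t ∇P`; hence it is a polynomial if and only if
some polynomial has these properties. Polynomials in `z` and `t` are taken as polynomials in `z`
over `ℂ[t]`, and `t` is `Polynomial.X`. -/
def HasPolynomialInversionPair {n : ℕ} (P : MvPolynomial (Fin n) ℂ) : Prop :=
  ∃ Q : MvPolynomial (Fin n) (Polynomial ℂ), 2 ≤ polyOrder Q ∧
    AreInverse
      (fun i => X i - C Polynomial.X * gradient (map Polynomial.C P) i)
      (fun i => X i + C Polynomial.X * gradient Q i)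

/-- The vanishing conjecture for all HN polynomials of degree at least `2`, in all dimensions. -/
def VanishingConjecture : Prop :=
  ∀ n : ℕ, 1 ≤ n → ∀ P : MvPolynomial (Fin n) ℂ,
    2 ≤ P.totalDegree → IsHN P → EventuallyVanishes P

/-- The vanishing conjecture for homogeneous HN polynomials of degree `d`, in all dimensions. -/
def HomogeneousVanishingConjecture (d : ℕ) : Prop :=
  ∀ n : ℕ, 1 ≤ n → ∀ P : MvPolynomial (Fin n) ℂ,
    P.IsHomogeneous d → IsHN P → EventuallyVanishes P

/-- The vanishing conjecture in terms of deformed inversion pairs; these are defined for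
polynomials of order at least `2`. -/
def InversionPairConjecture : Prop :=
  ∀ n : ℕ, 1 ≤ n → ∀ P : MvPolynomial (Fin n) ℂ,
    2 ≤ P.totalDegree → 2 ≤ polyOrder P → IsHN P → HasPolynomialInversionPair P

/-- The homogeneous version, in degree `d`, of the conjecture on deformed inversion pairs. -/
def HomogeneousInversionPairConjecture (d : ℕ) : Prop :=
  ∀ n : ℕ, 1 ≤ n → ∀ P : MvPolynomial (Fin n) ℂ,
    P.IsHomogeneous d → IsHN P → HasPolynomialInversionPair P

/-- The Jacobian conjecture, in all dimensions: a polynomial map `F = z - H` with `o(H) ≥ 2` and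
Jacobian determinant `1` has a polynomial inverse. -/
def JacobianConjecture : Prop :=
  ∀ n : ℕ, 1 ≤ n → ∀ H : PolyMap n ℂ,
    (∀ i, 2 ≤ polyOrder (H i)) →
    (jacobianMatrix (fun i => X i - H i)).det = 1 →
    ∃ G : PolyMap n ℂ, AreInverse (fun i => X i - H i) G

end HNPoly

/-! Both lists are closed by the cycle (1) → (4) → (3) → (2) → (1); the substance lies in (4) → (3)
and (1) → (4).

Analytic half. Let `g` be the power series in `t` with `g = z + t ∇P(g)`, the inverse of `z - t ∇P`,
and put `Q = P(g) - (t/2) |∇P(g)|²` (`hopfLax`). Then `∇Q = ∇P(g)`, so `g = z + t ∇Q`, and `Q`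
solves the Hamilton–Jacobi equation `2 ∂Q/∂t = |∇Q|²`. If `P` is HN, then also `ΔQ = 0`, being the
trace of a nilpotent matrix. The two equations give `Δ(Q^(m+1)) = 2(m+1) ∂(Q^m)/∂t`, hence `Δ^k
Q^(k+1) = 2^k (k+1)! ∂^k Q/∂t^k`. At `t = 0` this identifies `Δ^k P^(k+1)` with a nonzero multiple
of the coefficient of `t^k` in `Q` (`coeff_hopfLax`). So eventual vanishing says that `Q` is
polynomial in `t`, which links vanishing, inversion pairs and polynomial inverses. The Jacobian
conjecture, applied with `t` as an extra variable, makes `g` polynomial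
(`JacobianConjecture.exists_polynomial`).

Algebraic half. Degree 4 suffices because inverting a general map with Jacobian determinant 1
reduces to inverting `z - ∇P` with `P` a quartic HN polynomial. New variables first lower the degree
of `H` to 3 (`splitLift`), then make `H` cubic homogeneous (`cubicLift`), and doubling the variables
makes it a gradient (`potential`). Each stage preserves the determinant or nilpotency condition, and
surjectivity of the substitution homomorphism descends back to the original map
(`surjective_bind₁_of_retract`). Polynomial rings here are Noetherian, so surjectivity already
yields a polynomial inverse. -/

namespace HNPoly

open MvPolynomial

/-! ### Derivations and powers of a harmonic Hamilton–Jacobi solution. -/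

section Derivations

variable {σ : Type} [Fintype σ]

theorem derivation_aeval {A : Type*} [CommRing A] [Algebra ℂ A] (D : Derivation ℂ A A)
    (g : σ → A) (p : MvPolynomial σ ℂ) :
    D (aeval g p) = ∑ j, aeval g (pderiv j p) * D (g j) := by
  classical
  induction p using MvPolynomial.induction_on with
  | C a => simp
  | add p q hp hq => simp only [map_add, hp, hq, add_mul, Finset.sum_add_distrib]
  | mul_X p i hp =>
    simp only [map_mul, aeval_X, Derivation.leibniz, hp, smul_eq_mul, map_add, add_mul,
      Finset.sum_add_distrib, pderiv_X, Finset.mul_sum]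
    congr 1
    · rw [Finset.sum_eq_single i]
      · simp
      · intro j _ hj
        simp [hj.symm]
      · simp
    · exact Finset.sum_congr rfl fun j _ => by ring

theorem pderiv_comm {R : Type*} [CommRing R] {τ : Type*} (i j : τ) (p : MvPolynomial τ R) :
    pderiv i (pderiv j p) = pderiv j (pderiv i p) := by
  classical
  have h : ⁅(pderiv i : Derivation R (MvPolynomial τ R) (MvPolynomial τ R)),
      (pderiv j : Derivation R (MvPolynomial τ R) (MvPolynomial τ R))⁆ = 0 := by
    refine MvPolynomial.derivation_ext fun k => ?_
    simp [Derivation.commutator_apply, pderiv_X, Pi.single_apply, apply_ite]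
  have := DFunLike.congr_fun h p
  rw [Derivation.commutator_apply] at this
  exact sub_eq_zero.1 this

/-- The sum of the squares of a family of derivations. -/
noncomputable def sumSq {A : Type*} [CommRing A] [Algebra ℂ A] (D : σ → Derivation ℂ A A) :
    Module.End ℂ A :=
  ∑ i, (D i : A →ₗ[ℂ] A) * (D i : A →ₗ[ℂ] A)

theorem sumSq_apply {A : Type*} [CommRing A] [Algebra ℂ A] (D : σ → Derivation ℂ A A) (a : A) :
    sumSq D a = ∑ i, D i (D i a) := by
  simp [sumSq, LinearMap.sum_apply]

variable {A : Type*} [CommRing A] [Algebra ℂ A] (D : σ → Derivation ℂ A A) (T : Derivation ℂ A A)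

/-- By the product rule the left side is `(m+1) Q^m ΔQ + (m+1) m Q^(m-1) |∇Q|²`. The first term
vanishes, and in the second `|∇Q|² = 2 T Q` turns `m Q^(m-1) T Q` into `T (Q^m)`. -/
theorem sumSq_pow_succ {Q : A} (hT : 2 * T Q = ∑ i, D i Q ^ 2) (hL : sumSq D Q = 0) (m : ℕ) :
    sumSq D (Q ^ (m + 1)) = (2 * (m + 1) : ℂ) • T (Q ^ m) := by
  have h1 : ∀ i, D i (D i (Q ^ (m + 1))) =
      ((m : A) + 1) * (Q ^ m * D i (D i Q)) + ((m : A) + 1) * (m * Q ^ (m - 1)) * (D i Q) ^ 2 := by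
    intro i
    simp only [Derivation.leibniz_pow, Derivation.leibniz, smul_eq_mul, nsmul_eq_mul,
      Nat.add_sub_cancel, Derivation.map_natCast]
    push_cast
    ring
  rw [sumSq_apply] at hL ⊢
  rw [Finset.sum_congr rfl fun i _ => h1 i]
  simp only [Finset.sum_add_distrib, ← Finset.mul_sum, hL, ← hT, Derivation.leibniz_pow,
    smul_eq_mul, nsmul_eq_mul]
  rw [Algebra.smul_def]
  simp only [map_mul, map_add, map_natCast, map_one, map_ofNat]
  ring

theorem sumSq_iterate {Q : A} (hc : ∀ i a, T (D i a) = D i (T a))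
    (hT : 2 * T Q = ∑ i, D i Q ^ 2) (hL : sumSq D Q = 0) (k : ℕ) :
    (sumSq D ^ k) (Q ^ (k + 1)) = (2 ^ k * (k + 1).factorial : ℂ) • T^[k] Q := by
  have hcomm : Commute (T : Module.End ℂ A) (sumSq D) := by
    refine LinearMap.ext fun a => ?_
    simp [sumSq_apply, hc]
  have hpow : ∀ n a, (sumSq D ^ n) (T a) = T ((sumSq D ^ n) a) := fun n a =>
    (LinearMap.congr_fun (hcomm.pow_right n) a).symm
  induction k with
  | zero => simp
  | succ k ih =>
    rw [pow_succ, Module.End.mul_apply, sumSq_pow_succ D T hT hL, map_smul, hpow, ih,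
      Derivation.map_smul, smul_smul, Function.iterate_succ_apply']
    congr 1
    rw [Nat.factorial_succ (k + 1)]
    push_cast
    ring

end Derivations

/-! ### Derivations on power series in `t`. -/

section PowerSeries

open PowerSeries in
/-- A derivation of `R`, acting on the coefficients of power series over `R`. -/
noncomputable def coeffwise {R : Type*} [CommRing R] [Algebra ℂ R] (d : Derivation ℂ R R) :
    Derivation ℂ R⟦X⟧ R⟦X⟧ :=
  Derivation.mk'
    { toFun := fun f => PowerSeries.mk fun n => d (PowerSeries.coeff n f)
      map_add' := fun f g => by ext n; simp
      map_smul' := fun c f => by ext n; simp }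
    fun f g => by
      ext n
      simp only [LinearMap.coe_mk, AddHom.coe_mk, PowerSeries.coeff_mk, PowerSeries.coeff_mul, map_sum, Derivation.leibniz,
        smul_eq_mul, map_add, Finset.sum_add_distrib]
      congr 1
      rw [← Finset.Nat.sum_antidiagonal_swap]
      rfl

variable {R : Type*} [CommRing R] [Algebra ℂ R]

@[simp]
theorem coeff_coeffwise (d : Derivation ℂ R R) (f : PowerSeries R) (n : ℕ) :
    PowerSeries.coeff n (coeffwise d f) = d (PowerSeries.coeff n f) := by
  simp [coeffwise]

@[simp]
theorem coeffwise_X (d : Derivation ℂ R R) : coeffwise d PowerSeries.X = 0 := by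
  ext n
  simp [PowerSeries.coeff_X, apply_ite d]

@[simp]
theorem coeffwise_C (d : Derivation ℂ R R) (r : R) :
    coeffwise d (PowerSeries.C r) = PowerSeries.C (d r) := by
  ext n
  simp [PowerSeries.coeff_C, apply_ite d]

variable (R) in
/-- The derivative of power series over a `ℂ`-algebra, as a `ℂ`-derivation. -/
noncomputable def formalDeriv : Derivation ℂ (PowerSeries R) (PowerSeries R) :=
  (PowerSeries.derivative R).restrictScalars ℂ

theorem formalDeriv_apply (f : PowerSeries R) :
    formalDeriv R f = PowerSeries.derivative R f := rfl

theorem formalDeriv_coeffwise (d : Derivation ℂ R R) (f : PowerSeries R) :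
    formalDeriv R (coeffwise d f) = coeffwise d (formalDeriv R f) := by
  ext n
  simp only [formalDeriv_apply, PowerSeries.coeff_derivative, coeff_coeffwise, Derivation.leibniz]
  have : d ((n : R) + 1) = 0 := by
    rw [map_add, Derivation.map_natCast, Derivation.map_one_eq_zero, add_zero]
  simp [this, mul_comm]

theorem constantCoeff_iterate_formalDeriv (f : PowerSeries R) (n : ℕ) :
    PowerSeries.constantCoeff ((formalDeriv R)^[n] f) = n.factorial * PowerSeries.coeff n f :=
  PowerSeries.constantCoeff_iterate_derivative f n

end PowerSeries

/-- Formal power series in `t` over the polynomials in `n` variables. -/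
abbrev FPS (n : ℕ) : Type := PowerSeries (MvPolynomial (Fin n) ℂ)

/-! ### The formal inverse of `z - t ∇P` and its potential. -/

section Formal

variable {n : ℕ}

/-- The Hopf–Lax expression for the potential of the inverse map. -/
noncomputable def hopfLax (P : MvPolynomial (Fin n) ℂ) (g : Fin n → FPS n) : FPS n :=
  aeval g P - (2⁻¹ : ℂ) • (PowerSeries.X * ∑ i, aeval g (pderiv i P) ^ 2)

variable {P : MvPolynomial (Fin n) ℂ} {g : Fin n → FPS n}

/-- The chain rule on `P(g)` gives `∑ ∂ᵢP(g) ∂ⱼgᵢ`. Inserting the fixed-point equation for `gᵢ`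
leaves `∂ⱼP(g)` plus a term that the derivative of the quadratic correction cancels. Thus `g` is `z`
plus `t` times the gradient of the potential. -/
theorem coeffwise_hopfLax
    (hg : ∀ i, g i = PowerSeries.C (X i : MvPolynomial (Fin n) ℂ) + PowerSeries.X * aeval g (pderiv i P)) (j : Fin n) :
    coeffwise (pderiv j) (hopfLax P g) = aeval g (pderiv j P) := by
  have hD : ∀ i, coeffwise (pderiv j) (g i) = PowerSeries.C ((Pi.single i 1 : Fin n → MvPolynomial (Fin n) ℂ) j) +
      PowerSeries.X * coeffwise (pderiv j) (aeval g (pderiv i P)) := by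
    intro i
    conv_lhs => rw [hg i]
    simp [pderiv_X, Pi.single_apply, eq_comm]
  have hsum : ∑ i, aeval g (pderiv i P) * PowerSeries.C ((Pi.single i 1 : Fin n → MvPolynomial (Fin n) ℂ) j) =
      aeval g (pderiv j P) := by
    rw [Finset.sum_eq_single j]
    · simp
    · intro i _ hi
      simp [hi]
    · simp
  rw [hopfLax, map_sub, Derivation.map_smul, derivation_aeval]
  simp only [hD, mul_add, Finset.sum_add_distrib, hsum, Derivation.leibniz, coeffwise_X, map_sum,
    Derivation.leibniz_pow, smul_eq_mul, mul_zero, add_zero, Nat.add_one_sub_one, pow_one,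
    add_sub_assoc, add_eq_left, sub_eq_zero]
  rw [← Finset.smul_sum, mul_smul_comm, ← Nat.cast_smul_eq_nsmul ℂ, smul_smul, Finset.mul_sum]
  norm_num
  exact Finset.sum_congr rfl fun i _ => by ring

theorem formalDeriv_hopfLax
    (hg : ∀ i, g i = PowerSeries.C (X i : MvPolynomial (Fin n) ℂ) + PowerSeries.X * aeval g (pderiv i P)) :
    2 * formalDeriv _ (hopfLax P g) = ∑ i, aeval g (pderiv i P) ^ 2 := by
  have hC : ∀ r : MvPolynomial (Fin n) ℂ, formalDeriv _ (PowerSeries.C r) = 0 := fun r => by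
    simp [formalDeriv_apply]
  have hX : formalDeriv (MvPolynomial (Fin n) ℂ) PowerSeries.X = 1 := by
    simp [formalDeriv_apply]
  have hD : ∀ i, formalDeriv _ (g i) = aeval g (pderiv i P) +
      PowerSeries.X * formalDeriv _ (aeval g (pderiv i P)) := by
    intro i
    conv_lhs => rw [hg i]
    simp [hC, hX, add_comm]
  rw [hopfLax, map_sub, Derivation.map_smul, derivation_aeval]
  have h2 : ∀ a : FPS n, (2⁻¹ : ℂ) • (2 * a) = a := fun a => by
    rw [← smul_mul_assoc, Algebra.smul_def]
    have : (2 : FPS n) = algebraMap ℂ (FPS n) 2 := (map_ofNat _ 2).symm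
    rw [this, ← map_mul]
    norm_num
  rw [mul_sub, mul_smul_comm, h2]
  simp only [hD, Derivation.leibniz, hX, map_sum, mul_add, Finset.sum_add_distrib,
    Derivation.leibniz_pow, smul_eq_mul, nsmul_eq_mul, mul_one, Nat.add_one_sub_one, pow_one,
    Finset.mul_sum]
  rw [← sub_eq_zero, ← Finset.sum_add_distrib, ← Finset.sum_add_distrib, ← Finset.sum_sub_distrib,
    ← Finset.sum_sub_distrib]
  refine Finset.sum_eq_zero fun i _ => ?_
  push_cast
  ring

/-- Let `M` be the Hessian of `P` at `g` and `U` the Jacobian matrix of `g`. Differentiating the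
fixed-point equation gives `U = (1 - tM)⁻¹`, which commutes with `M`. So `MU`, the Hessian of the
potential, is nilpotent, and its trace vanishes because the ring is reduced. -/
theorem sumSq_hopfLax (hP : IsHN P)
    (hg : ∀ i, g i = PowerSeries.C (X i : MvPolynomial (Fin n) ℂ) + PowerSeries.X * aeval g (pderiv i P)) :
    sumSq (fun i => coeffwise (pderiv i)) (hopfLax P g) = 0 := by
  set M : Matrix (Fin n) (Fin n) (FPS n) := (hessian P).map (aeval g)
  set U : Matrix (Fin n) (Fin n) (FPS n) := Matrix.of fun i j => coeffwise (pderiv j) (g i)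
  have hM : IsNilpotent M := hP.map (AlgHom.mapMatrix (aeval g))
  have hW : M * U = Matrix.of fun i j => coeffwise (pderiv j) (aeval g (pderiv i P)) := by
    ext1 i j
    rw [Matrix.of_apply, derivation_aeval, Matrix.mul_apply]
    refine Finset.sum_congr rfl fun k _ => ?_
    simp [M, U, hessian, pderiv_comm i k]
  have hU : U = 1 + (PowerSeries.X : FPS n) • (M * U) := by
    rw [hW]
    ext1 i j
    simp only [U, Matrix.of_apply, Matrix.add_apply, Matrix.smul_apply, smul_eq_mul]
    conv_lhs => rw [hg i]
    simp only [map_add, Derivation.leibniz, coeffwise_X, coeffwise_C, pderiv_X, smul_eq_mul,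
      mul_zero, add_zero, Matrix.one_apply]
    simp [Pi.single_apply, apply_ite]
  have hinv : (1 - (PowerSeries.X : FPS n) • M) * U = 1 := by
    rw [sub_mul, one_mul, Matrix.smul_mul, sub_eq_iff_eq_add]
    exact hU
  have hinv' := mul_eq_one_comm.1 hinv
  have hc : Commute M (1 - (PowerSeries.X : FPS n) • M) :=
    (Commute.one_right M).sub_right ((Commute.refl M).smul_right _)
  have hcU : Commute M U := by
    have h1 : U * ((1 - (PowerSeries.X : FPS n) • M) * M) * U = U * (M * (1 - (PowerSeries.X : FPS n) • M)) * U := by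
      rw [hc.eq]
    rw [← mul_assoc, hinv', one_mul, mul_assoc U, mul_assoc M, hinv, mul_one] at h1
    exact h1
  have htr := (Matrix.isNilpotent_trace_of_isNilpotent (hcU.isNilpotent_mul_right hM)).eq_zero
  rw [hW] at htr
  rw [sumSq_apply]
  simpa [coeffwise_hopfLax hg, Matrix.trace] using htr

theorem constantCoeff_aeval (h : ∀ i, PowerSeries.constantCoeff (g i) = (X i : MvPolynomial (Fin n) ℂ))
    (p : MvPolynomial (Fin n) ℂ) : PowerSeries.constantCoeff (aeval g p) = p := by
  have : (PowerSeries.constantCoeff (R := MvPolynomial (Fin n) ℂ)).comp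
      (aeval g : MvPolynomial (Fin n) ℂ →ₐ[ℂ] FPS n).toRingHom = RingHom.id _ := by
    refine MvPolynomial.ringHom_ext (fun r => ?_) fun i => ?_
    · simp only [AlgHom.toRingHom_eq_coe, RingHom.coe_comp, RingHom.coe_coe, Function.comp_apply,
        RingHom.id_apply, algHom_C]
      rfl
    · simpa using h i
  exact RingHom.congr_fun this p

theorem coeff_hopfLax (hP : IsHN P)
    (hg : ∀ i, g i = PowerSeries.C (X i : MvPolynomial (Fin n) ℂ) + PowerSeries.X * aeval g (pderiv i P)) (k : ℕ) :
    laplacian^[k] (P ^ (k + 1)) =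
      (2 ^ k * (k + 1).factorial * k.factorial : ℂ) • PowerSeries.coeff k (hopfLax P g) := by
  have h1 : ∀ a : FPS n, PowerSeries.constantCoeff
      ((sumSq (fun i => coeffwise (pderiv i)) ^ k) a) = laplacian^[k] (PowerSeries.constantCoeff a) := by
    intro a
    induction k generalizing a with
    | zero => simp
    | succ k ih =>
      rw [pow_succ, Module.End.mul_apply, ih, Function.iterate_succ_apply]
      congr 1
      rw [sumSq_apply, laplacian, map_sum]
      refine Finset.sum_congr rfl fun i _ => ?_
      simp only [← PowerSeries.coeff_zero_eq_constantCoeff_apply, coeff_coeffwise]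
  -- Taking `∂/∂t` for `T` gives an identity of power series, which is then read off at `t = 0`.
  have h := sumSq_iterate (fun i => coeffwise (pderiv i)) (formalDeriv (MvPolynomial (Fin n) ℂ))
    (Q := hopfLax P g) (fun i a => formalDeriv_coeffwise _ a)
    (by simp only [coeffwise_hopfLax hg, formalDeriv_hopfLax hg]) (sumSq_hopfLax hP hg) k
  have hg0 : ∀ i, PowerSeries.constantCoeff (g i) = (X i : MvPolynomial (Fin n) ℂ) := fun i => by
    rw [hg i]
    simp
  have h2 : PowerSeries.constantCoeff (hopfLax P g) = P := by
    rw [hopfLax, map_sub, constantCoeff_aeval hg0, ← PowerSeries.coeff_zero_eq_constantCoeff_apply]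
    simp
  have h3 := congrArg PowerSeries.constantCoeff h
  rw [h1, map_pow, h2] at h3
  rw [h3, ← PowerSeries.coeff_zero_eq_constantCoeff_apply, PowerSeries.coeff_smul,
    PowerSeries.coeff_zero_eq_constantCoeff_apply, constantCoeff_iterate_formalDeriv, mul_smul _ (k.factorial : ℂ)]
  congr 1
  rw [Algebra.smul_def]
  simp

theorem aeval_sub_aeval_mem {B : Type*} [CommRing B] [Algebra ℂ B] (I : Ideal B) {σ : Type}
    {f g : σ → B} (h : ∀ i, f i - g i ∈ I) (p : MvPolynomial σ ℂ) :
    aeval f p - aeval g p ∈ I := by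
  rw [← Ideal.Quotient.eq]
  have h1 : ∀ u : σ → B, Ideal.Quotient.mk I (aeval u p) =
      aeval (fun i => Ideal.Quotient.mk I (u i)) p := fun u => by
    rw [← Ideal.Quotient.mkₐ_eq_mk ℂ, ← MvPolynomial.comp_aeval_apply]
  rw [h1, h1]
  congr 2
  funext i
  exact Ideal.Quotient.eq.2 (h i)

variable (P) in
/-- The successive approximations to the inverse of `z - t ∇P`. -/
noncomputable def approx : ℕ → Fin n → FPS n
  | 0 => fun _ => 0
  | k + 1 => fun i => PowerSeries.C (X i : MvPolynomial (Fin n) ℂ) + PowerSeries.X * aeval (approx k) (pderiv i P)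

theorem X_pow_succ_dvd_step {f h : Fin n → FPS n} {k : ℕ}
    (H : ∀ i, PowerSeries.X ^ k ∣ f i - h i) (p : MvPolynomial (Fin n) ℂ) (c : FPS n) :
    PowerSeries.X ^ (k + 1) ∣
      (c + PowerSeries.X * aeval f p) - (c + PowerSeries.X * aeval h p) := by
  rw [add_sub_add_left_eq_sub, ← mul_sub, pow_succ']
  refine mul_dvd_mul_left _ ?_
  rw [← Ideal.mem_span_singleton]
  exact aeval_sub_aeval_mem _ (fun i => Ideal.mem_span_singleton.2 (H i)) p

/-- The right side is a `t`-adic contraction in `g`, so the iterates `approx` converge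
coefficientwise to a fixed point. -/
theorem exists_formal_inverse (P : MvPolynomial (Fin n) ℂ) : ∃ g : Fin n → FPS n,
    ∀ i, g i = PowerSeries.C (X i : MvPolynomial (Fin n) ℂ) + PowerSeries.X * aeval g (pderiv i P) := by
  have h1 : ∀ k i, PowerSeries.X ^ k ∣ approx P (k + 1) i - approx P k i := by
    intro k
    induction k with
    | zero => simp
    | succ k ih => exact fun i => X_pow_succ_dvd_step ih _ _
  have h2 : ∀ m k, m + 1 ≤ k → ∀ i,
      PowerSeries.coeff m (approx P k i) = PowerSeries.coeff m (approx P (m + 1) i) := by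
    intro m k hk i
    induction k, hk using Nat.le_induction with
    | base => rfl
    | succ k hk ih =>
      rw [← ih, ← sub_eq_zero, ← map_sub]
      exact PowerSeries.X_pow_dvd_iff.1 (h1 k i) m hk
  let g : Fin n → FPS n := fun i => PowerSeries.mk fun m => PowerSeries.coeff m (approx P (m + 1) i)
  have h3 : ∀ k i, PowerSeries.X ^ k ∣ g i - approx P k i := by
    intro k i
    rw [PowerSeries.X_pow_dvd_iff]
    intro m hm
    simp [g, h2 m k hm i]
  refine ⟨g, fun i => ?_⟩
  rw [← sub_eq_zero]
  ext1 m
  rw [map_zero]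
  -- Modulo `t^(m+1)`, both sides of the fixed-point equation agree with the iterate `approx P (m +
  -- 1)`.
  have h4 := dvd_sub (h3 (m + 1) i) (X_pow_succ_dvd_step (h3 m) (pderiv i P) (PowerSeries.C (X i)))
  have h5 := PowerSeries.X_pow_dvd_iff.1 h4 m (Nat.lt_succ_self m)
  rw [← h5]
  congr 1
  simp only [approx]
  ring

/-- The inclusion of polynomials into power series, over `ℂ`. -/
noncomputable def toPowerSeriesHom (R : Type*) [CommRing R] [Algebra ℂ R] :
    Polynomial R →ₐ[ℂ] PowerSeries R :=
  { Polynomial.coeToPowerSeries.ringHom (R := R) with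
    commutes' := fun r => by
      ext n
      simp [Polynomial.algebraMap_apply, PowerSeries.algebraMap_apply] }

theorem toPowerSeriesHom_apply {R : Type*} [CommRing R] [Algebra ℂ R] (p : Polynomial R) :
    toPowerSeriesHom R p = p := rfl

theorem eventuallyVanishes_of_polynomial (hP : IsHN P)
    (g : Fin n → Polynomial (MvPolynomial (Fin n) ℂ))
    (hg : ∀ i, g i = Polynomial.C (X i : MvPolynomial (Fin n) ℂ) + Polynomial.X * aeval g (pderiv i P)) :
    EventuallyVanishes P := by
  have hcoe : ∀ p : MvPolynomial (Fin n) ℂ, ((aeval g p : Polynomial _) : FPS n) =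
      aeval (fun i => (g i : FPS n)) p := fun p => by
    exact MvPolynomial.comp_aeval_apply g (toPowerSeriesHom (MvPolynomial (Fin n) ℂ)) p
  have hg' : ∀ i, (g i : FPS n) = PowerSeries.C (X i : MvPolynomial (Fin n) ℂ) +
      PowerSeries.X * aeval (fun i => (g i : FPS n)) (pderiv i P) := fun i => by
    conv_lhs => rw [hg i]
    simp [hcoe]
  let q : Polynomial (MvPolynomial (Fin n) ℂ) :=
    aeval g P - (2⁻¹ : ℂ) • (Polynomial.X * ∑ i, aeval g (pderiv i P) ^ 2)
  have hq : hopfLax P (fun i => (g i : FPS n)) = q := by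
    rw [← toPowerSeriesHom_apply, hopfLax]
    simp only [q, map_sub, map_smul, map_mul, map_sum, map_pow, toPowerSeriesHom_apply, hcoe,
      Polynomial.coe_X]
  refine ⟨q.natDegree + 1, fun k hk => ?_⟩
  rw [coeff_hopfLax hP hg', hq, Polynomial.coeff_coe, Polynomial.coeff_eq_zero_of_natDegree_lt hk,
    smul_zero]

end Formal

/-! ### Polynomial inverses from surjectivity or a one-sided inverse. -/

section Inverse

/-- The kernels of `f^k` stabilize, say at `k`. An element of `ker f` has the form `f^k y`, so `y ∈
ker f^(k+1) = ker f^k`, and the element is zero. -/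
theorem injective_of_surjective_ringHom {B : Type*} [CommRing B] [IsNoetherianRing B] (f : B →+* B)
    (hf : Function.Surjective f) : Function.Injective f := by
  have hmono : Monotone fun k : ℕ => RingHom.ker (f ^ k) := by
    refine monotone_nat_of_le_succ fun k x hx => ?_
    rw [RingHom.mem_ker] at hx ⊢
    rw [pow_succ', RingHom.mul_def, RingHom.comp_apply, hx, map_zero]
  obtain ⟨k, hk⟩ := monotone_stabilizes_iff_noetherian.2 inferInstance ⟨_, hmono⟩
  have hs : Function.Surjective (f ^ k) := by
    rw [RingHom.coe_pow]
    exact hf.iterate k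
  rw [injective_iff_map_eq_zero]
  intro x hx
  obtain ⟨y, rfl⟩ := hs x
  have h1 : y ∈ RingHom.ker (f ^ (k + 1)) := by
    rw [RingHom.mem_ker, pow_succ', RingHom.mul_def, RingHom.comp_apply, hx]
  have h2 : y ∈ RingHom.ker (f ^ k) := by
    have := hk (k + 1) (Nat.le_succ k)
    simp only [OrderHom.coe_mk] at this
    rw [this]
    exact h1
  exact h2

variable {n : ℕ} {R : Type*} [CommRing R] [IsNoetherianRing R]

theorem exists_areInverse_of_surjective {F : PolyMap n R}
    (hF : Function.Surjective (bind₁ F : MvPolynomial (Fin n) R →ₐ[R] MvPolynomial (Fin n) R)) :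
    ∃ G : PolyMap n R, AreInverse F G := by
  have hinj := injective_of_surjective_ringHom (bind₁ F).toRingHom hF
  choose G hG using fun i => hF (X i)
  refine ⟨G, funext fun i => hinj ?_, funext hG⟩
  have h : (bind₁ F).comp (bind₁ G) = AlgHom.id R _ := MvPolynomial.algHom_ext fun i => by
    simp [hG]
  simpa [PolyMap.comp] using AlgHom.congr_fun h (F i)

theorem areInverse_of_comp_eq {F G : PolyMap n R} (h : F.comp G = X) : AreInverse F G := by
  have hc : (bind₁ G).comp (bind₁ F) = AlgHom.id R _ := MvPolynomial.algHom_ext fun i => by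
    simpa [PolyMap.comp] using congrFun h i
  have hinj := injective_of_surjective_ringHom (bind₁ G).toRingHom
    fun p => ⟨bind₁ F p, AlgHom.congr_fun hc p⟩
  refine ⟨h, funext fun i => hinj ?_⟩
  simpa [PolyMap.comp] using AlgHom.congr_fun hc (G i)

end Inverse

/-! ### Order under differentiation, sums and powers. -/

section Order

variable {R : Type*} [CommRing R]

theorem le_polyOrder_iff {n k : ℕ} {P : MvPolynomial (Fin n) R} :
    (k : ℕ∞) ≤ polyOrder P ↔ ∀ m, coeff m P ≠ 0 → k ≤ m.degree := by
  constructor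
  · intro h m hm
    have := MvPowerSeries.order_le (f := (P : MvPowerSeries (Fin n) R)) (d := m) (by simpa using hm)
    exact_mod_cast h.trans this
  · intro h
    refine MvPowerSeries.nat_le_order fun m hm => ?_
    by_contra hne
    exact absurd (h m (by simpa using hne)) (by omega)

variable {n : ℕ}

theorem polyOrder_pderiv {k : ℕ} {P : MvPolynomial (Fin n) R}
    (h : ((k + 1 : ℕ) : ℕ∞) ≤ polyOrder P) (i : Fin n) : (k : ℕ∞) ≤ polyOrder (pderiv i P) := by
  rw [le_polyOrder_iff] at h ⊢
  intro m hm
  rw [coeff_pderiv] at hm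
  have := h _ (left_ne_zero_of_mul hm)
  simp only [map_add, Finsupp.degree_single] at this
  omega

theorem polyOrder_sum {ι : Type*} {k : ℕ} (s : Finset ι) {f : ι → MvPolynomial (Fin n) R}
    (h : ∀ i ∈ s, (k : ℕ∞) ≤ polyOrder (f i)) : (k : ℕ∞) ≤ polyOrder (∑ i ∈ s, f i) := by
  rw [le_polyOrder_iff]
  intro m hm
  rw [coeff_sum] at hm
  obtain ⟨i, hi, hne⟩ := Finset.exists_ne_zero_of_sum_ne_zero hm
  exact le_polyOrder_iff.1 (h i hi) m hne

theorem polyOrder_laplacian_iterate {k j : ℕ} {P : MvPolynomial (Fin n) R}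
    (h : ((k + 2 * j : ℕ) : ℕ∞) ≤ polyOrder P) : (k : ℕ∞) ≤ polyOrder (laplacian^[j] P) := by
  induction j generalizing P with
  | zero => simpa using h
  | succ j ih =>
    rw [Function.iterate_succ_apply]
    exact ih (polyOrder_sum _ fun i _ => polyOrder_pderiv (polyOrder_pderiv h i) i)

theorem polyOrder_pow {k : ℕ} {P : MvPolynomial (Fin n) R}
    (h : (k : ℕ∞) ≤ polyOrder P) (j : ℕ) : ((k * j : ℕ) : ℕ∞) ≤ polyOrder (P ^ j) := by
  have h1 : j • (k : ℕ∞) ≤ polyOrder (P ^ j) := by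
    unfold polyOrder at h ⊢
    rw [coe_pow]
    exact (nsmul_le_nsmul_right h j).trans (MvPowerSeries.le_order_pow j)
  refine le_trans (le_of_eq ?_) h1
  simp [mul_comm]

end Order

/-! ### From eventual vanishing to a polynomial inversion pair. -/

section Transfer

variable {n : ℕ}

/-- Polynomials in `z` over `ℂ[t]`, regarded as polynomials in `t` over `ℂ[z]`. -/
noncomputable def swapVars (n : ℕ) :
    MvPolynomial (Fin n) (Polynomial ℂ) →+* Polynomial (MvPolynomial (Fin n) ℂ) :=
  eval₂Hom (Polynomial.mapRingHom C) fun i => Polynomial.C (X i)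

theorem swapVars_injective : Function.Injective (swapVars n) := by
  refine Function.LeftInverse.injective
    (g := Polynomial.eval₂RingHom (MvPolynomial.map Polynomial.C) (C Polynomial.X)) fun p => ?_
  have : (Polynomial.eval₂RingHom (MvPolynomial.map Polynomial.C) (C Polynomial.X)).comp
      (swapVars n) = RingHom.id _ := by
    refine MvPolynomial.ringHom_ext (fun r => ?_) fun i => ?_
    · induction r using Polynomial.induction_on' with
      | add p q hp hq => simp only [map_add, hp, hq]
      | monomial k a =>
        simp only [swapVars, RingHom.coe_comp, Function.comp_apply, coe_eval₂Hom, eval₂_C,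
          Polynomial.coe_mapRingHom, Polynomial.map_monomial, Polynomial.coe_eval₂RingHom,
          Polynomial.eval₂_monomial, map_C, RingHom.id_apply]
        rw [← map_pow, ← map_mul, Polynomial.C_mul_X_pow_eq_monomial]
    · simp [swapVars]
  exact RingHom.congr_fun this p

/-- Polynomials in `z` over `ℂ[t]`, regarded as power series in `t` over `ℂ[z]`. -/
noncomputable def expand (n : ℕ) : MvPolynomial (Fin n) (Polynomial ℂ) →+* FPS n :=
  (toPowerSeriesHom (MvPolynomial (Fin n) ℂ)).toRingHom.comp (swapVars n)

/-- This allows identities between polynomials over `ℂ[t]` to be checked among power series in `t`,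
where the formal inverse lives. -/
theorem expand_injective : Function.Injective (expand n) := by
  refine Function.Injective.comp (g := toPowerSeriesHom (MvPolynomial (Fin n) ℂ)) ?_
    swapVars_injective
  exact Polynomial.coe_injective _

@[simp]
theorem expand_X (i : Fin n) : expand n (X i) = PowerSeries.C (X i : MvPolynomial (Fin n) ℂ) := by
  simp [expand, swapVars, toPowerSeriesHom_apply]

@[simp]
theorem expand_C_X : expand n (C Polynomial.X) = PowerSeries.X := by
  simp [expand, swapVars, toPowerSeriesHom_apply]

@[simp]
theorem expand_C_C (a : ℂ) :
    expand n (C (Polynomial.C a)) = PowerSeries.C (C a : MvPolynomial (Fin n) ℂ) := by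
  simp [expand, swapVars, toPowerSeriesHom_apply]

theorem expand_bind₁ (G : PolyMap n (Polynomial ℂ)) (p : MvPolynomial (Fin n) ℂ) :
    expand n (bind₁ G (MvPolynomial.map Polynomial.C p)) = aeval (fun i => expand n (G i)) p := by
  induction p using MvPolynomial.induction_on with
  | C a =>
    simp only [map_C, algHom_C]
    simp only [MvPolynomial.algebraMap_eq, expand_C_C]
    simp [PowerSeries.algebraMap_apply]
  | add p q hp hq => simp only [map_add, hp, hq]
  | mul_X p i hp => simp only [map_mul, hp, map_X, bind₁_X_right, aeval_X]

@[simp]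
theorem expand_map (p : MvPolynomial (Fin n) ℂ) :
    expand n (MvPolynomial.map Polynomial.C p) = PowerSeries.C p := by
  induction p using MvPolynomial.induction_on with
  | C a => simp
  | add p q hp hq => simp only [map_add, hp, hq]
  | mul_X p i hp => simp only [map_mul, hp, map_X, expand_X]

theorem expand_pderiv (j : Fin n) (p : MvPolynomial (Fin n) (Polynomial ℂ)) :
    expand n (pderiv j p) = coeffwise (pderiv j) (expand n p) := by
  induction p using MvPolynomial.induction_on with
  | C a =>
    rw [pderiv_C, map_zero]
    induction a using Polynomial.induction_on' with
    | add p q hp hq => simp only [map_add, ← hp, ← hq, add_zero]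
    | monomial k a =>
      rw [← Polynomial.C_mul_X_pow_eq_monomial]
      simp
  | add p q hp hq => simp only [map_add, hp, hq]
  | mul_X p i hp =>
    simp only [Derivation.leibniz, map_mul, hp, map_add, smul_eq_mul, expand_X, coeffwise_C,
      pderiv_X]
    congr 2
    simp [Pi.single_apply, apply_ite]

theorem hasPolynomialInversionPair_of_eventuallyVanishes {P : MvPolynomial (Fin n) ℂ}
    (hP : IsHN P) (ho : 2 ≤ polyOrder P) (hv : EventuallyVanishes P) :
    HasPolynomialInversionPair P := by
  obtain ⟨g, hg⟩ := exists_formal_inverse P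
  obtain ⟨N, hN⟩ := hv
  set q : ℕ → MvPolynomial (Fin n) ℂ := fun k => PowerSeries.coeff k (hopfLax P g) with hq
  have hc : ∀ k : ℕ, (2 ^ k * (k + 1).factorial * k.factorial : ℂ) ≠ 0 := fun k => by
    have h1 : ((k + 1).factorial : ℂ) ≠ 0 := Nat.cast_ne_zero.2 (Nat.factorial_ne_zero _)
    have h2 : (k.factorial : ℂ) ≠ 0 := Nat.cast_ne_zero.2 (Nat.factorial_ne_zero _)
    exact mul_ne_zero (mul_ne_zero (pow_ne_zero _ two_ne_zero) h1) h2
  have hq0 : ∀ k, N ≤ k → q k = 0 := fun k hk => by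
    have := coeff_hopfLax hP hg k
    rw [hN k hk, eq_comm, smul_eq_zero] at this
    exact this.resolve_left (hc k)
  -- `P^(k+1)` has order at least `2k + 2`, and `k` Laplacians lower the order by at most `2k`.
  have hq2 : ∀ k, ((2 : ℕ) : ℕ∞) ≤ polyOrder (q k) := fun k => by
    have h1 : ((2 : ℕ) : ℕ∞) ≤ polyOrder (laplacian^[k] (P ^ (k + 1))) :=
      polyOrder_laplacian_iterate (by
        have := polyOrder_pow (k := 2) (by exact_mod_cast ho) (k + 1)
        rwa [mul_add, mul_one, add_comm] at this)
    rw [coeff_hopfLax hP hg k, le_polyOrder_iff] at h1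
    refine le_polyOrder_iff.2 fun m hm => h1 m ?_
    rw [coeff_smul]
    exact smul_ne_zero (hc k) hm
  let Q : MvPolynomial (Fin n) (Polynomial ℂ) :=
    ∑ k ∈ Finset.range N, C (Polynomial.X ^ k) * MvPolynomial.map Polynomial.C (q k)
  have hQ : expand n Q = hopfLax P g := by
    ext1 m
    simp only [Q, map_sum, map_mul, map_pow, expand_C_X, expand_map, PowerSeries.coeff_mul_C,
      PowerSeries.coeff_X_pow]
    rw [← show q m = PowerSeries.coeff m (hopfLax P g) from rfl]
    by_cases hm : m < N
    · simp [hm]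
    · simp [hm, hq0 m (not_lt.1 hm)]
  have hG : ∀ i, expand n (X i + C Polynomial.X * gradient Q i) = g i := fun i => by
    rw [map_add, map_mul, gradient, expand_pderiv, hQ, coeffwise_hopfLax hg, expand_X, expand_C_X]
    exact (hg i).symm
  refine ⟨Q, ?_, areInverse_of_comp_eq (funext fun i => expand_injective ?_)⟩
  · refine polyOrder_sum (k := 2) _ fun k _ => le_polyOrder_iff.2 fun m hm => ?_
    rw [coeff_C_mul, coeff_map] at hm
    refine le_polyOrder_iff.1 (hq2 k) m fun h0 => hm ?_
    rw [h0, map_zero, mul_zero]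
  · simp only [PolyMap.comp, map_sub, map_mul, bind₁_X_right]
    rw [hG, algHom_C, MvPolynomial.algebraMap_eq, expand_C_X, gradient, pderiv_map, expand_bind₁,
      expand_X]
    simp only [hG]
    conv_lhs => rw [hg i]
    exact add_sub_cancel_right _ _

end Transfer

/-! ### Order bounds for arbitrary variable types. -/

section OrderAtLeast

variable {σ τ : Type} {R : Type*} [CommRing R]

/-- All monomials of `p` have degree at least `k`. -/
def OrderAtLeast (k : ℕ) (p : MvPolynomial σ R) : Prop :=
  ∀ m, coeff m p ≠ 0 → k ≤ m.degree

namespace OrderAtLeast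

variable {k l : ℕ} {p q : MvPolynomial σ R}

theorem mono (hp : OrderAtLeast k p) (h : l ≤ k) : OrderAtLeast l p :=
  fun m hm => h.trans (hp m hm)

theorem add (hp : OrderAtLeast k p) (hq : OrderAtLeast k q) : OrderAtLeast k (p + q) := by
  intro m hm
  by_cases h : coeff m p = 0
  · exact hq m fun h' => hm (by rw [coeff_add, h, h', add_zero])
  · exact hp m h

theorem neg (hp : OrderAtLeast k p) : OrderAtLeast k (-p) := fun m hm => hp m (by simpa using hm)

theorem sub (hp : OrderAtLeast k p) (hq : OrderAtLeast k q) : OrderAtLeast k (p - q) := by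
  rw [sub_eq_add_neg]
  exact hp.add hq.neg

theorem zero : OrderAtLeast k (0 : MvPolynomial σ R) := fun m hm => absurd (coeff_zero m) hm

theorem sum {ι : Type*} (s : Finset ι) {f : ι → MvPolynomial σ R}
    (h : ∀ i ∈ s, OrderAtLeast k (f i)) : OrderAtLeast k (∑ i ∈ s, f i) := by
  classical
  induction s using Finset.induction_on with
  | empty => exact zero
  | insert i s hi ih =>
    rw [Finset.sum_insert hi]
    exact (h i (Finset.mem_insert_self _ _)).add
      (ih fun j hj => h j (Finset.mem_insert_of_mem hj))

theorem mul (hp : OrderAtLeast k p) (hq : OrderAtLeast l q) : OrderAtLeast (k + l) (p * q) := by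
  classical
  intro m hm
  rw [coeff_mul] at hm
  obtain ⟨x, hx, hne⟩ := Finset.exists_ne_zero_of_sum_ne_zero hm
  rw [← Finset.HasAntidiagonal.mem_antidiagonal.1 hx, map_add]
  exact add_le_add (hp _ (left_ne_zero_of_mul hne)) (hq _ (right_ne_zero_of_mul hne))

theorem of_isHomogeneous (hp : p.IsHomogeneous k) : OrderAtLeast k p := fun m hm =>
  le_of_eq (by by_contra h; exact hm (hp.coeff_eq_zero fun h' => h h'.symm))

theorem of_constantCoeff (hp : coeff 0 p = 0) : OrderAtLeast 1 p := by
  intro m hm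
  by_contra h
  have : m = 0 := (Finsupp.degree_eq_zero_iff m).1 (by omega)
  exact hm (this ▸ hp)

theorem rename {f : σ → τ} (hp : OrderAtLeast k p) : OrderAtLeast k (MvPolynomial.rename f p) := by
  intro m hm
  obtain ⟨u, rfl, hu⟩ := coeff_rename_ne_zero f p m hm
  simpa [Finsupp.degree_mapDomain] using hp u hu

end OrderAtLeast

end OrderAtLeast

/-! ### Jacobian determinants and reindexing of variables. -/

section Jacobian

variable {σ τ : Type} [Fintype σ] [DecidableEq σ]

/-- The Jacobian matrix of a family of polynomials. -/
noncomputable def jac (F : σ → MvPolynomial σ ℂ) : Matrix σ σ (MvPolynomial σ ℂ) :=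
  Matrix.of fun i j => pderiv j (F i)

/-- Over a domain the characteristic polynomial of a nilpotent matrix is a pure power of the
variable; evaluate it at 1. -/
theorem det_one_sub_of_isNilpotent {B : Type*} [CommRing B] [IsDomain B] {N : Matrix σ σ B}
    (hN : IsNilpotent N) : (1 - N).det = 1 := by
  have h1 := (Matrix.isNilpotent_charpoly_sub_pow_of_isNilpotent hN).eq_zero
  have h2 := congrArg (Polynomial.eval 1) (sub_eq_zero.1 h1)
  rw [Matrix.eval_charpoly] at h2
  simpa using h2

theorem jac_rename [Fintype τ] [DecidableEq τ] (e : σ ≃ τ) (F : σ → MvPolynomial σ ℂ) :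
    (jac fun i => rename e (F (e.symm i))).det = rename e (jac F).det := by
  rw [AlgHom.map_det, ← Matrix.det_submatrix_equiv_self e.symm]
  congr 1
  ext1 i j
  simp only [jac, Matrix.of_apply, AlgHom.mapMatrix_apply, Matrix.submatrix_apply, Matrix.map_apply]
  rw [← pderiv_rename e.injective, e.apply_symm_apply]

theorem JacobianConjecture.exists_inverse (hJ : JacobianConjecture) [Nonempty σ]
    (H : σ → MvPolynomial σ ℂ) (ho : ∀ i, OrderAtLeast 2 (H i))
    (hdet : (jac fun i => X i - H i).det = 1) :
    ∃ G : σ → MvPolynomial σ ℂ, ∀ i, bind₁ G (X i - H i) = X i := by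
  let e := Fintype.equivFin σ
  have hX : ∀ i, (X i - rename e (H (e.symm i)) : MvPolynomial _ ℂ) =
      rename e (X (e.symm i) - H (e.symm i)) := fun i => by simp
  obtain ⟨G, hG, -⟩ := hJ (Fintype.card σ) Fintype.card_pos
    (fun i => rename e (H (e.symm i))) (fun i => le_polyOrder_iff.2 (ho _).rename) (by
      have := jac_rename e fun i => X i - H i
      rw [hdet, map_one] at this
      rw [← this]
      congr 2
      simp only [hX])
  refine ⟨fun i => rename e.symm (G (e i)), fun i => ?_⟩
  have hK : (rename e.symm).comp ((bind₁ G).comp (rename e)) =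
      bind₁ (fun i => rename e.symm (G (e i))) :=
    MvPolynomial.algHom_ext fun j => by simp
  have h : bind₁ G (rename e (X i - H i)) = X (e i) := by
    have := congrFun hG (e i)
    rw [PolyMap.comp, hX, e.symm_apply_apply] at this
    exact this
  rw [← hK, AlgHom.comp_apply, AlgHom.comp_apply, h, rename_X, e.symm_apply_apply]

end Jacobian

/-! ### The Jacobian conjecture implies the vanishing conjecture. -/

section Vanishing

variable {n : ℕ}

theorem JacobianConjecture.exists_polynomial (hJ : JacobianConjecture)
    {P : MvPolynomial (Fin n) ℂ} (hP : IsHN P) :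
    ∃ g : Fin n → Polynomial (MvPolynomial (Fin n) ℂ),
      ∀ i, g i = Polynomial.C (X i : MvPolynomial (Fin n) ℂ) +
        Polynomial.X * aeval g (pderiv i P) := by
  -- The order of `P` is not restricted, so `t ∇P` may contain linear terms `t aᵢ`. Subtracting them
  -- makes the order at least 2.
  let a : Fin n → ℂ := fun i => coeff 0 (pderiv i P)
  let H : Fin n ⊕ Unit → MvPolynomial (Fin n ⊕ Unit) ℂ :=
    Sum.elim (fun i => X (Sum.inr ()) * rename Sum.inl (pderiv i P - C (a i))) fun _ => 0
  have ho : ∀ i, OrderAtLeast 2 (H i) := by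
    rintro (i | i)
    · exact OrderAtLeast.mul (k := 1) (l := 1) (.of_isHomogeneous (isHomogeneous_X _ _))
        (OrderAtLeast.rename (.of_constantCoeff (by rw [coeff_sub, coeff_zero_C, sub_self])))
    · exact OrderAtLeast.zero
  have hdet : (jac fun i => X i - H i).det = 1 := by
    have h1 : (jac fun i => X i - H i) = Matrix.fromBlocks
        (1 - (X (Sum.inr ()) : MvPolynomial (Fin n ⊕ Unit) ℂ) • (hessian P).map (rename Sum.inl))
        (Matrix.of fun i _ => - rename Sum.inl (pderiv i P - C (a i))) 0 1 := by
      ext1 (i | i) (j | j)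
      · simp [jac, H, pderiv_X, Matrix.one_apply, Pi.single_apply, hessian, pderiv_comm i j,
          pderiv_rename Sum.inl_injective, eq_comm]
      · have : pderiv (Sum.inr j) (rename Sum.inl (pderiv i P) : MvPolynomial (Fin n ⊕ Unit) ℂ) = 0 :=
          pderiv_eq_zero_of_notMem_vars fun h => by
            classical
            simpa using vars_rename _ _ h
        simp [jac, H, pderiv_X, this]
      · simp [jac, H, pderiv_X]
      · simp [jac, H, pderiv_X]
    rw [h1, Matrix.det_fromBlocks_zero₂₁, Matrix.det_one, mul_one]
    exact det_one_sub_of_isNilpotent ((hP.map (AlgHom.mapMatrix (rename Sum.inl))).smul _)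
  obtain ⟨G, hG⟩ := hJ.exists_inverse H ho hdet
  have hGt : G (Sum.inr ()) = X (Sum.inr ()) := by simpa [H] using hG (Sum.inr ())
  -- Evaluating the inverse at `z + ta` instead of `z` puts the removed terms `t aᵢ` back.
  let θ : MvPolynomial (Fin n ⊕ Unit) ℂ →ₐ[ℂ] Polynomial (MvPolynomial (Fin n) ℂ) :=
    aeval (Sum.elim (fun j => Polynomial.C (X j) + Polynomial.X * Polynomial.C (C (a j)))
      fun _ => Polynomial.X)
  refine ⟨fun i => θ (G (Sum.inl i)), fun i => ?_⟩
  have h := congrArg θ (hG (Sum.inl i))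
  have hcomp : θ (bind₁ (G ∘ Sum.inl) (pderiv i P)) =
      aeval (fun i => θ (G (Sum.inl i))) (pderiv i P) :=
    MvPolynomial.comp_aeval_apply (G ∘ Sum.inl) θ (pderiv i P)
  have hCa : θ (C (a i)) = Polynomial.C (C (a i)) := by
    simp [θ, Polynomial.algebraMap_apply]
  have hθX : θ (X (Sum.inr ())) = Polynomial.X := by simp [θ]
  have hθX' : θ (X (Sum.inl i)) =
      Polynomial.C (X i) + Polynomial.X * Polynomial.C (C (a i)) := by simp [θ]
  simp only [H, Sum.elim_inl, map_sub, map_mul, bind₁_X_right, hGt, bind₁_rename, hcomp, hθX, hθX',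
    rename_C, bind₁_C_right, hCa] at h
  linear_combination h

theorem JacobianConjecture.eventuallyVanishes (hJ : JacobianConjecture)
    {P : MvPolynomial (Fin n) ℂ} (hP : IsHN P) : EventuallyVanishes P := by
  obtain ⟨g, hg⟩ := hJ.exists_polynomial hP
  exact eventuallyVanishes_of_polynomial hP g hg

end Vanishing

/-! ### Nilpotency of the Jacobian matrix in the homogeneous case. -/

section Scaling

variable {σ : Type} [Fintype σ] [DecidableEq σ]

omit [DecidableEq σ] in
theorem aeval_mul_of_isHomogeneous {B : Type*} [CommRing B] [Algebra ℂ B] {k : ℕ}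
    {p : MvPolynomial σ ℂ} (hp : p.IsHomogeneous k) (c : B) (x : σ → B) :
    aeval (fun i => c * x i) p = c ^ k * aeval x p := by
  simp only [aeval_def, eval₂_eq', Finset.mul_sum]
  refine Finset.sum_congr rfl fun d hd => ?_
  simp only [mul_pow, Finset.prod_mul_distrib, Finset.prod_pow_eq_pow_sum]
  rw [← Finsupp.degree_eq_sum, show d.degree = k from (hp.degree_eq_sum_deg_support hd).symm]
  ring

/-- Reversal 1 forces the monic characteristic polynomial to have only its leading term;
Cayley–Hamilton then applies. -/
theorem isNilpotent_of_charpolyRev {B : Type*} [CommRing B] [Nontrivial B] {M : Matrix σ σ B}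
    (h : M.charpolyRev = 1) : IsNilpotent M := by
  rw [← Matrix.reverse_charpoly] at h
  have h1 : M.charpoly = Polynomial.X ^ M.charpoly.natDegree := by
    ext k
    rw [Polynomial.coeff_X_pow]
    rcases lt_trichotomy k M.charpoly.natDegree with hk | hk | hk
    · have h2 := congrArg (Polynomial.coeff · (M.charpoly.natDegree - k)) h
      simp only [Polynomial.coeff_reverse, Polynomial.coeff_one] at h2
      rw [Polynomial.revAt_le (Nat.sub_le _ _), Nat.sub_sub_self hk.le] at h2
      rw [h2, if_neg (by omega), if_neg hk.ne]
    · rw [if_pos hk, hk]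
      exact M.charpoly_monic
    · rw [if_neg hk.ne', Polynomial.coeff_eq_zero_of_natDegree_lt hk]
  refine ⟨M.charpoly.natDegree, ?_⟩
  have h3 := M.aeval_self_charpoly
  rw [h1, map_pow, Polynomial.aeval_X] at h3
  exact h3

theorem isNilpotent_jac {k : ℕ} {H : σ → MvPolynomial σ ℂ}
    (hH : ∀ i, (H i).IsHomogeneous (k + 2)) (hdet : (jac fun i => X i - H i).det = 1) :
    IsNilpotent (jac H) := by
  -- The entries of `jac H` have degree `k + 1`, so scaling `z` by `T` turns the determinant
  -- condition into `det (1 - T^(k+1) jac H) = 1`. This is the reversed characteristic polynomial at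
  -- `T^(k+1)`, and `expand` is injective.
  refine isNilpotent_of_charpolyRev (Polynomial.expand_injective (Nat.succ_pos k) ?_)
  let θ : MvPolynomial σ ℂ →ₐ[ℂ] Polynomial (MvPolynomial σ ℂ) :=
    aeval fun i => Polynomial.X * Polynomial.C (X i)
  have hC : ∀ p : MvPolynomial σ ℂ,
      aeval (fun i => Polynomial.C (X i : MvPolynomial σ ℂ)) p = Polynomial.C p := fun p => by
    have := MvPolynomial.comp_aeval_apply (B := Polynomial (MvPolynomial σ ℂ)) X
      (Polynomial.CAlgHom (R := ℂ) (A := MvPolynomial σ ℂ)) p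
    rw [aeval_X_left_apply] at this
    exact this.symm
  have hθ : ∀ i j, θ (pderiv j (H i)) =
      Polynomial.X ^ (k + 1) * Polynomial.C (pderiv j (H i)) := fun i j => by
    rw [← hC]
    exact aeval_mul_of_isHomogeneous (hH i).pderiv _ _
  have h1 := congrArg θ hdet
  rw [map_one, AlgHom.map_det] at h1
  rw [map_one, ← h1, Matrix.charpolyRev, AlgHom.map_det]
  congr 1
  ext1 i j
  simp only [AlgHom.mapMatrix_apply, Matrix.map_apply, Matrix.sub_apply, jac, Matrix.of_apply,
    map_sub, hθ, Matrix.smul_apply, smul_eq_mul, map_mul, Polynomial.expand_X, pderiv_X,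
    Polynomial.expand_C]
  congr 1
  simp [Pi.single_apply, Matrix.one_apply, apply_ite]

end Scaling

/-! ### Descent of surjectivity. -/

section Retract

variable {σ τ : Type}

theorem surjective_of_retract {B B' : Type*} {f : B → B} {f' : B' → B'} {φ ψ : B' → B}
    (h : ∀ x, φ (f' x) = f (ψ x)) (hφ : Function.Surjective φ) (hf : Function.Surjective f') :
    Function.Surjective f := fun b => by
  obtain ⟨x, rfl⟩ := hφ b
  obtain ⟨y, rfl⟩ := hf x
  exact ⟨ψ y, (h y).symm⟩

/-- Geometrically, `φ` and `ψ` are two maps from the small space to the large one, `φ` being a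
closed embedding, and `F'` carries the first to the second composed with `F`. Every reduction below
descends in this way. -/
theorem surjective_bind₁_of_retract {F : σ → MvPolynomial σ ℂ} {F' : τ → MvPolynomial τ ℂ}
    {φ ψ : MvPolynomial τ ℂ →ₐ[ℂ] MvPolynomial σ ℂ} (h : ∀ i, φ (F' i) = bind₁ F (ψ (X i)))
    (hφ : ∀ i, ∃ p, φ p = X i) (hF : Function.Surjective (bind₁ F')) :
    Function.Surjective (bind₁ F) := by
  refine surjective_of_retract (φ := φ) (ψ := ψ) (fun x => ?_) (fun p => ?_) hF
  · have : φ.comp (bind₁ F') = (bind₁ F).comp ψ := MvPolynomial.algHom_ext fun i => by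
      simpa using h i
    exact AlgHom.congr_fun this x
  · choose s hs using hφ
    refine ⟨aeval s p, ?_⟩
    rw [MvPolynomial.comp_aeval_apply]
    simp [hs]

end Retract

/-! ### Reduction of cubic homogeneous maps to gradient maps. -/

section Symmetric

variable {σ : Type} [Fintype σ] [DecidableEq σ]

/-- The Hessian matrix of a polynomial in the variables `σ`. -/
noncomputable def hess (P : MvPolynomial σ ℂ) : Matrix σ σ (MvPolynomial σ ℂ) :=
  Matrix.of fun i j => pderiv i (pderiv j P)

theorem HomogeneousInversionPairConjecture.surjective_fin
    (hI : HomogeneousInversionPairConjecture 4) {n : ℕ} (hn : 1 ≤ n) {P : MvPolynomial (Fin n) ℂ}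
    (hP : P.IsHomogeneous 4) (hN : IsHN P) :
    Function.Surjective (bind₁ fun i => X i - pderiv i P) := by
  obtain ⟨Q, -, -, hQ⟩ := hI n hn P hP hN
  intro p
  have h : ∀ i, ∃ q, bind₁ (fun i => X i - pderiv i P) q = X i := fun i => by
    -- Putting `t = 1` in the inversion pair gives a preimage of the variable.
    refine ⟨MvPolynomial.map (Polynomial.evalRingHom 1) (X i + C Polynomial.X * gradient Q i), ?_⟩
    have h := congrArg (MvPolynomial.map (Polynomial.evalRingHom 1)) (congrFun hQ i)
    rw [PolyMap.comp, map_bind₁, map_X] at h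
    rw [← h]
    congr 2
    funext j
    have hid : (Polynomial.evalRingHom (1 : ℂ)).comp Polynomial.C = RingHom.id ℂ := by
      ext
      simp
    rw [map_sub, map_X, map_mul, map_C, gradient, pderiv_map, map_map, hid, map_id]
    simp
  choose s hs using h
  refine ⟨aeval s p, ?_⟩
  rw [MvPolynomial.comp_aeval_apply]
  simp [hs]

theorem HomogeneousInversionPairConjecture.surjective
    (hI : HomogeneousInversionPairConjecture 4) [Nonempty σ] {P : MvPolynomial σ ℂ}
    (hP : P.IsHomogeneous 4) (hN : IsNilpotent (hess P)) :
    Function.Surjective (bind₁ fun i => X i - pderiv i P) := by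
  let e := Fintype.equivFin σ
  have hN' : IsHN (rename e P) := by
    have h1 : hessian (rename e P) =
        Matrix.reindexAlgEquiv ℂ _ e ((rename e).mapMatrix (hess P)) := by
      ext1 i j
      simp only [hessian, hess, Matrix.of_apply, Matrix.coe_reindexAlgEquiv,
        Matrix.reindex_apply, Matrix.submatrix_apply, AlgHom.mapMatrix_apply, Matrix.map_apply]
      rw [← pderiv_rename e.injective, ← pderiv_rename e.injective, e.apply_symm_apply,
        e.apply_symm_apply]
    rw [IsHN, h1]
    exact (hN.map _).map _
  refine surjective_bind₁_of_retract (φ := (rename e.symm)) (ψ := (rename e.symm)) (fun i => ?_)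
    (fun i => ⟨X (e i), by simp⟩)
    (hI.surjective_fin Fintype.card_pos hP.rename_isHomogeneous hN')
  have h2 : pderiv i (rename e P) = rename e (pderiv (e.symm i) P) := by
    rw [← pderiv_rename e.injective, e.apply_symm_apply]
  rw [h2]
  simp [rename_rename]

variable (σ) in
/-- The substitution of `a + i b` for the variables. -/
noncomputable def complexify : MvPolynomial σ ℂ →ₐ[ℂ] MvPolynomial (σ ⊕ σ) ℂ :=
  aeval fun i => X (Sum.inl i) + C Complex.I * X (Sum.inr i)

theorem pderiv_inl_complexify (j : σ) (p : MvPolynomial σ ℂ) :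
    pderiv (Sum.inl j) (complexify σ p) = complexify σ (pderiv j p) := by
  rw [complexify, derivation_aeval, Finset.sum_eq_single j]
  · simp
  · intro i _ hi
    simp [pderiv_X, hi]
  · simp

theorem pderiv_inr_complexify (j : σ) (p : MvPolynomial σ ℂ) :
    pderiv (Sum.inr j) (complexify σ p) = C Complex.I * complexify σ (pderiv j p) := by
  rw [complexify, derivation_aeval, Finset.sum_eq_single j]
  · simp [mul_comm]
  · intro i _ hi
    simp [pderiv_X, hi]
  · simp

/-- The pairing of `a - i b` with a family of polynomials in `a + i b`. -/
noncomputable def conjPairing (H : σ → MvPolynomial σ ℂ) : MvPolynomial (σ ⊕ σ) ℂ :=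
  ∑ k, (X (Sum.inl k) - C Complex.I * X (Sum.inr k)) * complexify σ (H k)

theorem pderiv_inl_conjPairing (j : σ) (H : σ → MvPolynomial σ ℂ) :
    pderiv (Sum.inl j) (conjPairing H) =
      complexify σ (H j) + conjPairing fun k => pderiv j (H k) := by
  simp only [conjPairing, map_sum, Derivation.leibniz, smul_eq_mul, pderiv_inl_complexify,
    Finset.sum_add_distrib]
  rw [add_comm]
  congr 1
  rw [Finset.sum_eq_single j]
  · simp
  · intro i _ hi
    simp [pderiv_X, hi]
  · simp

theorem pderiv_inr_conjPairing (j : σ) (H : σ → MvPolynomial σ ℂ) :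
    pderiv (Sum.inr j) (conjPairing H) =
      C Complex.I * ((conjPairing fun k => pderiv j (H k)) - complexify σ (H j)) := by
  simp only [conjPairing, map_sum, Derivation.leibniz, smul_eq_mul, pderiv_inr_complexify,
    Finset.sum_add_distrib, mul_sub, Finset.mul_sum]
  rw [sub_eq_add_neg]
  congr 1
  · exact Finset.sum_congr rfl fun k _ => by ring
  · rw [Finset.sum_eq_single j]
    · simp [mul_comm]
    · intro i _ hi
      simp [pderiv_X, hi]
    · simp

/-- The potential whose gradient map contains the map `z - H`. -/
noncomputable def potential (H : σ → MvPolynomial σ ℂ) : MvPolynomial (σ ⊕ σ) ℂ :=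
  C (1 / 2) * conjPairing H

omit [DecidableEq σ] in
theorem isHomogeneous_potential {k : ℕ} {H : σ → MvPolynomial σ ℂ}
    (hH : ∀ i, (H i).IsHomogeneous k) : (potential H).IsHomogeneous (1 + k) := by
  refine IsHomogeneous.C_mul (IsHomogeneous.sum _ _ _ fun i _ => IsHomogeneous.mul ?_ ?_) _
  · exact (isHomogeneous_X _ _).sub (isHomogeneous_C_mul_X _ _)
  · simpa only [one_mul, complexify] using (hH i).aeval (n := 1) (fun i => X (Sum.inl i) + C Complex.I * X (Sum.inr i))
      fun i => (isHomogeneous_X _ _).add (isHomogeneous_C_mul_X _ _)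

theorem isNilpotent_fromBlocks {B : Type*} [CommRing B] {K L T : Matrix σ σ B}
    (hK : IsNilpotent K) (hL : IsNilpotent L) : IsNilpotent (Matrix.fromBlocks K 0 T L) := by
  have hpow : ∀ m : ℕ, ∃ U, Matrix.fromBlocks K 0 T L ^ m = Matrix.fromBlocks (K ^ m) 0 U (L ^ m) := by
    intro m
    induction m with
    | zero => exact ⟨0, by simp⟩
    | succ m ih =>
      obtain ⟨U, hU⟩ := ih
      exact ⟨U * K + L ^ m * T, by simp [pow_succ, hU, Matrix.fromBlocks_multiply]⟩
  obtain ⟨a, ha⟩ := hK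
  obtain ⟨b, hb⟩ := hL
  obtain ⟨U, hU⟩ := hpow (a + b)
  refine ⟨(a + b) * 2, ?_⟩
  rw [pow_mul, hU, pow_add K, pow_add L, ha, hb, zero_mul, mul_zero, sq,
    Matrix.fromBlocks_multiply]
  simp

theorem C_I_mul_self {τ : Type} : (C Complex.I * C Complex.I : MvPolynomial τ ℂ) = -1 := by
  rw [← C_mul, Complex.I_mul_I, C_neg, C_1]

theorem C_half {τ : Type} : (2 * C (1 / 2) : MvPolynomial τ ℂ) = 1 := by
  rw [show (2 : MvPolynomial τ ℂ) = C 2 from (map_ofNat C 2).symm, ← C_mul]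
  norm_num

section BlockConjugation

variable {B : Type*} [CommRing B] {ι c : B}

/-- The change of coordinates is `(a, b) ↦ (a + ib, a - ib)`. There the Hessian of `potential H`
becomes block triangular with diagonal blocks `K` and its transpose, where `K` is `jac H` at `a +
ib`; thus nilpotency passes from `K` to the Hessian. -/
theorem conj_block_mul (hι : ι * ι = -1) (hc : 2 * c = 1) (K T : Matrix σ σ B) :
    Matrix.fromBlocks 1 (ι • 1) 1 (-ι • 1) *
      Matrix.fromBlocks (c • (K.transpose + K + T)) ((c * ι) • (K - K.transpose + T))
        ((c * ι) • (K.transpose - K + T)) (c • (K.transpose + K - T)) =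
    Matrix.fromBlocks K 0 T K.transpose * Matrix.fromBlocks 1 (ι • 1) 1 (-ι • 1) := by
  rw [Matrix.fromBlocks_multiply, Matrix.fromBlocks_multiply, Matrix.fromBlocks_inj]
  refine ⟨?_, ?_, ?_, ?_⟩ <;> ext1 i j <;>
  simp only [Matrix.one_mul, Matrix.mul_one, Matrix.smul_mul, Matrix.mul_smul,
    Matrix.smul_apply, Matrix.add_apply, Matrix.sub_apply, Matrix.transpose_apply, smul_eq_mul,
    Matrix.zero_apply, add_zero, smul_zero]
  · linear_combination (c * (K j i - K i j + T i j)) * hι + K i j * hc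
  · linear_combination ι * K i j * hc
  · linear_combination (-c * (K j i - K i j + T i j)) * hι + (K j i + T i j) * hc
  · linear_combination ι * (T i j - K j i) * hc

theorem isNilpotent_of_conj_block [IsDomain B] (hι : ι * ι = -1) (hc : 2 * c = 1) {K T : Matrix σ σ B}
    (hK : IsNilpotent K) :
    IsNilpotent (Matrix.fromBlocks (c • (K.transpose + K + T)) ((c * ι) • (K - K.transpose + T))
      ((c * ι) • (K.transpose - K + T)) (c • (K.transpose + K - T))) := by
  have h2 : (2 : B) ≠ 0 := left_ne_zero_of_mul_eq_one hc
  have hconj := conj_block_mul hι hc K T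
  set M := Matrix.fromBlocks (c • (K.transpose + K + T)) ((c * ι) • (K - K.transpose + T))
    ((c * ι) • (K.transpose - K + T)) (c • (K.transpose + K - T))
  set L : Matrix (σ ⊕ σ) (σ ⊕ σ) B := Matrix.fromBlocks 1 (ι • 1) 1 (-ι • 1) with hLdef
  have hL : Matrix.fromBlocks 1 1 (-ι • 1) (ι • 1) * L = (2 : B) • 1 := by
    rw [hLdef, Matrix.fromBlocks_multiply, ← Matrix.fromBlocks_one, Matrix.fromBlocks_smul,
      Matrix.fromBlocks_inj]
    refine ⟨?_, ?_, ?_, ?_⟩ <;> simp [smul_smul, hι, two_smul]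
  have hB : IsNilpotent (Matrix.fromBlocks K 0 T K.transpose) := by
    refine isNilpotent_fromBlocks hK ?_
    obtain ⟨m, hm⟩ := hK
    exact ⟨m, by rw [← Matrix.transpose_pow, hm, Matrix.transpose_zero]⟩
  obtain ⟨m, hm⟩ := hB
  have hpow : ∀ k : ℕ, L * M ^ k = Matrix.fromBlocks K 0 T K.transpose ^ k * L := by
    intro k
    induction k with
    | zero => simp
    | succ k ih => rw [pow_succ, ← mul_assoc, ih, mul_assoc, hconj, ← mul_assoc, ← pow_succ]
  refine ⟨m, ?_⟩
  have h3 : (2 : B) • M ^ m = 0 := by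
    rw [← one_mul (M ^ m), ← Matrix.smul_mul, ← hL, mul_assoc, hpow, hm, zero_mul, mul_zero]
  exact (smul_eq_zero.1 h3).resolve_left h2

end BlockConjugation

theorem isNilpotent_hess_potential {H : σ → MvPolynomial σ ℂ} (hH : IsNilpotent (jac H)) :
    IsNilpotent (hess (potential H)) := by
  have hM : hess (potential H) = Matrix.fromBlocks
      ((C (1 / 2) : MvPolynomial (σ ⊕ σ) ℂ) • (((complexify σ).mapMatrix (jac H)).transpose +
        (complexify σ).mapMatrix (jac H) +
        Matrix.of fun l j => conjPairing fun k => pderiv l (pderiv j (H k))))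
      ((C (1 / 2) * C Complex.I : MvPolynomial (σ ⊕ σ) ℂ) • ((complexify σ).mapMatrix (jac H) -
        ((complexify σ).mapMatrix (jac H)).transpose +
        Matrix.of fun l j => conjPairing fun k => pderiv l (pderiv j (H k))))
      ((C (1 / 2) * C Complex.I : MvPolynomial (σ ⊕ σ) ℂ) •
        (((complexify σ).mapMatrix (jac H)).transpose - (complexify σ).mapMatrix (jac H) +
        Matrix.of fun l j => conjPairing fun k => pderiv l (pderiv j (H k))))
      ((C (1 / 2) : MvPolynomial (σ ⊕ σ) ℂ) • (((complexify σ).mapMatrix (jac H)).transpose +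
        (complexify σ).mapMatrix (jac H) -
        Matrix.of fun l j => conjPairing fun k => pderiv l (pderiv j (H k)))) := by
    have hι : (C Complex.I * C Complex.I : MvPolynomial (σ ⊕ σ) ℂ) = -1 := C_I_mul_self
    ext1 (l | l) (j | j) <;>
    simp only [hess, potential, Matrix.of_apply, pderiv_C_mul, pderiv_inl_conjPairing,
      pderiv_inr_conjPairing, pderiv_inl_complexify, pderiv_inr_complexify, map_add, map_sub,
      Matrix.fromBlocks_apply₁₁, Matrix.fromBlocks_apply₁₂, Matrix.fromBlocks_apply₂₁,
      Matrix.fromBlocks_apply₂₂, Matrix.smul_apply, Matrix.add_apply, Matrix.sub_apply,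
      Matrix.transpose_apply, AlgHom.mapMatrix_apply, Matrix.map_apply, jac, smul_eq_mul]
    · ring
    · ring
    · ring
    · linear_combination (C (1 / 2) * (conjPairing (fun k => pderiv l (pderiv j (H k))) -
        complexify σ (pderiv j (H l)) - complexify σ (pderiv l (H j)))) * hι
  rw [hM]
  exact isNilpotent_of_conj_block C_I_mul_self C_half (hH.map (complexify σ).mapMatrix)

theorem HomogeneousInversionPairConjecture.surjective_cubic
    (hI : HomogeneousInversionPairConjecture 4) [Nonempty σ] {H : σ → MvPolynomial σ ℂ}
    (hH : ∀ i, (H i).IsHomogeneous 3) (hdet : (jac fun i => X i - H i).det = 1) :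
    Function.Surjective (bind₁ fun i => X i - H i) := by
  have hs := hI.surjective (P := potential H) (isHomogeneous_potential hH)
    (isNilpotent_hess_potential (isNilpotent_jac hH hdet))
  -- The substitution `a = z/2`, `b = -iz/2` parametrizes the subspace `a - ib = 0` with `a + ib =
  -- z`. The pairing vanishes there, and `z - ∇(potential H)` restricts to `z - H`.
  let φ : MvPolynomial (σ ⊕ σ) ℂ →ₐ[ℂ] MvPolynomial σ ℂ :=
    aeval (Sum.elim (fun i => C (1 / 2) * X i) fun i => -(C (1 / 2) * C Complex.I * X i))
  have h2 : (2 * C (1 / 2) : MvPolynomial σ ℂ) = 1 := C_half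
  have hι : (C Complex.I * C Complex.I : MvPolynomial σ ℂ) = -1 := C_I_mul_self
  have hl : ∀ i, φ (X (Sum.inl i)) = C (1 / 2) * X i := fun i => by simp [φ]
  have hr : ∀ i, φ (X (Sum.inr i)) = -(C (1 / 2) * C Complex.I * X i) := fun i => by simp [φ]
  have hC : ∀ a, φ (C a) = C a := fun a => φ.commutes a
  have hφ : ∀ p, φ (complexify σ p) = p := fun p => by
    have : φ.comp (complexify σ) = AlgHom.id ℂ _ := MvPolynomial.algHom_ext fun i => by
      simp only [AlgHom.comp_apply, complexify, aeval_X, map_add, map_mul, hl, hr, hC,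
        AlgHom.id_apply]
      linear_combination X i * h2 - C (1 / 2) * X i * hι
    exact AlgHom.congr_fun this p
  have hpair : ∀ H : σ → MvPolynomial σ ℂ, φ (conjPairing H) = 0 := fun H => by
    simp only [conjPairing, map_sum, map_mul, map_sub, hl, hr, hC]
    refine Finset.sum_eq_zero fun k _ => ?_
    linear_combination (C (1 / 2) * X k * φ (complexify σ (H k))) * hι
  refine surjective_bind₁_of_retract (φ := φ) (ψ := φ) ?_ (fun i => ⟨_, hφ (X i)⟩) hs
  rintro (i | i)
  · simp only [potential, pderiv_C_mul, pderiv_inl_conjPairing, map_sub, map_mul, map_add, hpair,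
      hφ, hl, hC, bind₁_X_right, bind₁_C_right]
    ring
  · simp only [potential, pderiv_C_mul, pderiv_inr_conjPairing, map_sub, map_mul, map_neg, hpair,
      hφ, hr, hC, bind₁_X_right, bind₁_C_right]
    ring

end Symmetric

/-! ### Partial derivatives in variables absent from a renamed polynomial. -/

section Rename

variable {σ τ : Type}

theorem pderiv_rename_of_ne {f : σ → τ} {i : τ} (h : ∀ j, f j ≠ i) (p : MvPolynomial σ ℂ) :
    pderiv i (rename f p) = 0 := by
  classical
  refine pderiv_eq_zero_of_notMem_vars fun hi => ?_
  obtain ⟨j, -, hj⟩ := Finset.mem_image.1 (vars_rename f p hi)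
  exact h j hj

end Rename

/-! ### From degrees 2 and 3 to cubic homogeneous maps. -/

section CubicHomogenization

variable {σ : Type} [Fintype σ] [DecidableEq σ]

/-- The cubic homogeneous map attached to a quadratic and a cubic homogeneous map. -/
noncomputable def cubicLift (H₂ H₃ : σ → MvPolynomial σ ℂ) :
    (σ ⊕ Unit) ⊕ σ → MvPolynomial ((σ ⊕ Unit) ⊕ σ) ℂ :=
  Sum.elim
    (Sum.elim (fun i => X (Sum.inl (Sum.inr ())) * rename (Sum.inl ∘ Sum.inl) (H₂ i) -
      X (Sum.inl (Sum.inr ())) ^ 2 * X (Sum.inr i)) fun _ => 0)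
    fun i => -rename (Sum.inl ∘ Sum.inl) (H₃ i)

variable {H₂ H₃ : σ → MvPolynomial σ ℂ}

omit [Fintype σ] [DecidableEq σ] in
theorem isHomogeneous_cubicLift (h₂ : ∀ i, (H₂ i).IsHomogeneous 2)
    (h₃ : ∀ i, (H₃ i).IsHomogeneous 3) (i : (σ ⊕ Unit) ⊕ σ) :
    (cubicLift H₂ H₃ i).IsHomogeneous 3 := by
  rcases i with (i | i) | i
  · exact ((isHomogeneous_X _ _).mul (h₂ i).rename_isHomogeneous).sub
      ((isHomogeneous_X_pow _ 2).mul (isHomogeneous_X _ _))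
  · exact isHomogeneous_zero _ _ _
  · exact (h₃ i).rename_isHomogeneous.neg

/-- Eliminating the last block by a Schur complement leaves `1 - t jac H₂ - t² jac H₃`. By
homogeneity this is the Jacobian matrix of `z - H₂ - H₃` at `tz`, whose determinant is still 1. -/
theorem det_jac_cubicLift (h₂ : ∀ i, (H₂ i).IsHomogeneous 2)
    (h₃ : ∀ i, (H₃ i).IsHomogeneous 3) (hdet : (jac fun i => X i - (H₂ i + H₃ i)).det = 1) :
    (jac fun i => X i - cubicLift H₂ H₃ i).det = 1 := by
  let ρ : MvPolynomial σ ℂ →ₐ[ℂ] MvPolynomial ((σ ⊕ Unit) ⊕ σ) ℂ := rename (Sum.inl ∘ Sum.inl)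
  let t : MvPolynomial ((σ ⊕ Unit) ⊕ σ) ℂ := X (Sum.inl (Sum.inr ()))
  have hρ : ∀ j p, pderiv (Sum.inl (Sum.inl j)) (ρ p) = ρ (pderiv j p) := fun j p =>
    pderiv_rename (Sum.inl_injective.comp Sum.inl_injective) j p
  have hρt : ∀ j p, pderiv (Sum.inl (Sum.inr j)) (ρ p) = 0 := fun j p =>
    pderiv_rename_of_ne (by simp) p
  have hρy : ∀ j p, pderiv (Sum.inr j) (ρ p) = 0 := fun j p =>
    pderiv_rename_of_ne (by simp) p
  have h1 : (jac fun i => X i - cubicLift H₂ H₃ i) = Matrix.fromBlocks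
      (Matrix.fromBlocks (1 - t • (jac H₂).map ρ)
        (Matrix.of fun i _ => 2 * t * X (Sum.inr i) - ρ (H₂ i)) 0 1)
      (Matrix.fromRows (t ^ 2 • 1) 0) (Matrix.fromCols ((jac H₃).map ρ) 0) 1 := by
    ext1 ((i | i) | i) ((j | j) | j)
    · simp [jac, cubicLift, pderiv_X, Matrix.one_apply, Pi.single_apply, hρ, t, ρ, eq_comm]
    · simp [jac, cubicLift, pderiv_X, hρt, t, ρ]
      ring
    · simp [jac, cubicLift, pderiv_X, Matrix.one_apply, Pi.single_apply, hρy, t, ρ]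
    · simp [jac, cubicLift, pderiv_X]
    · simp [jac, cubicLift, pderiv_X]
    · simp [jac, cubicLift, pderiv_X]
    · simp [jac, cubicLift, pderiv_X, hρ, ρ]
    · simp [jac, cubicLift, pderiv_X, hρt, ρ]
    · simp [jac, cubicLift, pderiv_X, Matrix.one_apply, Pi.single_apply, hρy, ρ]
  let θ : MvPolynomial σ ℂ →ₐ[ℂ] MvPolynomial ((σ ⊕ Unit) ⊕ σ) ℂ :=
    aeval fun i => t * X (Sum.inl (Sum.inl i))
  have hρX : ∀ p, ρ p = aeval (fun i => X (Sum.inl (Sum.inl i))) p := fun p =>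
    AlgHom.congr_fun (MvPolynomial.algHom_ext fun i => by simp [ρ]) p
  have hθ : ∀ k (p : MvPolynomial σ ℂ), p.IsHomogeneous k → θ p = t ^ k * ρ p := fun k p hp => by
    rw [aeval_mul_of_isHomogeneous hp, ← hρX]
  rw [h1, Matrix.det_fromBlocks_one₂₂, Matrix.fromRows_mul_fromCols]
  simp only [Matrix.smul_mul, Matrix.one_mul, Matrix.mul_zero, Matrix.zero_mul, sub_eq_add_neg,
    Matrix.fromBlocks_neg, Matrix.fromBlocks_add, neg_zero, add_zero]
  rw [Matrix.det_fromBlocks_zero₂₁, Matrix.det_one, mul_one, ← map_one θ, ← hdet, AlgHom.map_det]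
  congr 1
  ext1 i j
  simp only [Matrix.add_apply, Matrix.neg_apply, Matrix.smul_apply, Matrix.map_apply, jac,
    Matrix.of_apply, AlgHom.mapMatrix_apply, map_sub, map_add, hθ _ _ (h₂ i).pderiv,
    hθ _ _ (h₃ i).pderiv, pderiv_X, smul_eq_mul, Matrix.one_apply, Pi.single_apply, apply_ite θ,
    map_one, map_zero]
  ring

omit [Fintype σ] [DecidableEq σ] in
theorem surjective_of_cubicLift
    (hs : Function.Surjective (bind₁ fun i => X i - cubicLift H₂ H₃ i)) :
    Function.Surjective (bind₁ fun i => X i - (H₂ i + H₃ i)) := by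
  -- With the remaining variables written `y`, the lifted map sends the graph `t = 1`, `y = -H₃` to
  -- the plane `t = 1`, `y = 0`, acting as `z - H₂ - H₃` on the first coordinates.
  let φ : MvPolynomial ((σ ⊕ Unit) ⊕ σ) ℂ →ₐ[ℂ] MvPolynomial σ ℂ :=
    aeval (Sum.elim (Sum.elim X fun _ => 1) fun i => -H₃ i)
  let ψ : MvPolynomial ((σ ⊕ Unit) ⊕ σ) ℂ →ₐ[ℂ] MvPolynomial σ ℂ :=
    aeval (Sum.elim (Sum.elim X fun _ => 1) fun _ => 0)
  have hφ : ∀ p, φ (rename (Sum.inl ∘ Sum.inl) p) = p := fun p => by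
    simp only [φ, aeval_rename]
    exact aeval_X_left_apply p
  refine surjective_bind₁_of_retract (φ := φ) (ψ := ψ) ?_
    (fun i => ⟨X (Sum.inl (Sum.inl i)), by simp [φ]⟩) hs
  rintro ((i | i) | i)
  · simp only [cubicLift, Sum.elim_inl, map_sub, map_mul, hφ, map_pow]
    simp [φ, ψ]
  · simp [cubicLift, φ, ψ]
  · simp only [cubicLift, Sum.elim_inr, map_sub, map_neg, hφ]
    simp [φ, ψ]

end CubicHomogenization

/-! ### Lowering the degree by stabilization. -/

section DegreeReduction

variable {σ ι : Type} [Fintype σ] [DecidableEq σ] [Fintype ι] [DecidableEq ι]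

/-- The stabilization that replaces the products `P a * Q i a` by terms of lower degree. -/
noncomputable def splitLift (L : σ → MvPolynomial σ ℂ) (P : ι → MvPolynomial σ ℂ)
    (Q : σ → ι → MvPolynomial σ ℂ) :
    σ ⊕ (ι ⊕ σ × ι) → MvPolynomial (σ ⊕ (ι ⊕ σ × ι)) ℂ :=
  Sum.elim
    (fun i => rename Sum.inl (L i) - ∑ a,
      (X (Sum.inr (Sum.inl a)) * X (Sum.inr (Sum.inr (i, a))) +
        X (Sum.inr (Sum.inl a)) * rename Sum.inl (Q i a) +
        X (Sum.inr (Sum.inr (i, a))) * rename Sum.inl (P a)))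
    (Sum.elim (fun a => -rename Sum.inl (P a)) fun b => -rename Sum.inl (Q b.1 b.2))

variable {L : σ → MvPolynomial σ ℂ} {P : ι → MvPolynomial σ ℂ} {Q : σ → ι → MvPolynomial σ ℂ}

/-- With new variables `u`, `v`, the first coordinates of the lifted map are `z - L - ∑ PQ + ∑ (u +
P)(v + Q)` and the others are `u + P`, `v + Q`. The products `PQ` cancel, which lowers the degree,
while the determinant is unaffected: the Schur complement is the original Jacobian matrix by the
product rule. -/
theorem det_jac_splitLift :
    (jac fun i => X i - splitLift L P Q i).det =
      rename Sum.inl (jac fun i => X i - (L i + ∑ a, P a * Q i a)).det := by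
  let ρ : MvPolynomial σ ℂ →ₐ[ℂ] MvPolynomial (σ ⊕ (ι ⊕ σ × ι)) ℂ := rename Sum.inl
  let u : ι → MvPolynomial (σ ⊕ (ι ⊕ σ × ι)) ℂ := fun a => X (Sum.inr (Sum.inl a))
  let v : σ → ι → MvPolynomial (σ ⊕ (ι ⊕ σ × ι)) ℂ := fun i a => X (Sum.inr (Sum.inr (i, a)))
  have hρ : ∀ j p, pderiv (Sum.inl j) (ρ p) = ρ (pderiv j p) := fun j p =>
    pderiv_rename Sum.inl_injective j p
  have hρ' : ∀ j p, pderiv (Sum.inr j) (ρ p) = 0 := fun j p =>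
    pderiv_rename_of_ne (by simp) p
  have h1 : (jac fun i => X i - splitLift L P Q i) = Matrix.fromBlocks
      (Matrix.of fun i j => ρ (pderiv j (X i)) - ρ (pderiv j (L i)) +
        ∑ a, (u a * ρ (pderiv j (Q i a)) + v i a * ρ (pderiv j (P a))))
      (Matrix.of fun i => Sum.elim (fun a => v i a + ρ (Q i a))
        fun b => if i = b.1 then u b.2 + ρ (P b.2) else 0)
      (Matrix.of (Sum.elim (fun a j => ρ (pderiv j (P a)))
        fun b j => ρ (pderiv j (Q b.1 b.2)))) 1 := by
    ext1 (i | a | ⟨k, a⟩) (j | b | ⟨l, b⟩)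
    · simp only [jac, splitLift, Matrix.of_apply, Sum.elim_inl, map_sub, map_sum, map_add,
        Derivation.leibniz, pderiv_X, Matrix.fromBlocks_apply₁₁, smul_eq_mul]
      simp [u, v, ρ, Pi.single_apply, apply_ite, hρ, sub_add]
    · simp only [jac, splitLift, Matrix.of_apply, Sum.elim_inl, map_sub, map_sum, map_add,
        Derivation.leibniz, pderiv_X, Matrix.fromBlocks_apply₁₂, smul_eq_mul]
      simp [v, ρ, Pi.single_apply, hρ', Finset.sum_add_distrib]
    · simp only [jac, splitLift, Matrix.of_apply, Sum.elim_inl, map_sub, map_sum, map_add,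
        Derivation.leibniz, pderiv_X, Matrix.fromBlocks_apply₁₂, smul_eq_mul]
      by_cases h : i = l <;>
      simp [u, v, ρ, Pi.single_apply, hρ', Finset.sum_add_distrib, h]
    · simp [jac, splitLift, pderiv_X, hρ, ρ]
    · simp [jac, splitLift, pderiv_X, hρ', ρ, Pi.single_apply, Matrix.one_apply]
    · simp [jac, splitLift, pderiv_X, hρ', ρ]
    · simp [jac, splitLift, pderiv_X, hρ, ρ]
    · simp [jac, splitLift, pderiv_X, hρ', ρ]
    · simp [jac, splitLift, pderiv_X, hρ', ρ, Pi.single_apply, Matrix.one_apply]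
  rw [h1, Matrix.det_fromBlocks_one₂₂, AlgHom.map_det]
  congr 1
  ext1 i j
  simp only [Matrix.sub_apply, Matrix.of_apply, Matrix.mul_apply, Fintype.sum_sum_type,
    Sum.elim_inl, Sum.elim_inr, AlgHom.mapMatrix_apply, Matrix.map_apply, jac, map_sub, map_add,
    map_sum, Derivation.leibniz, smul_eq_mul, map_mul, Fintype.sum_prod_type, ite_mul, zero_mul]
  rw [Finset.sum_comm (f := fun k a => ite _ _ _)]
  simp only [Finset.sum_ite_eq, Finset.mem_univ, if_true]
  change _ = ρ _ - (ρ _ + ∑ a, (ρ _ * ρ _ + ρ _ * ρ _))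
  have hs : ∑ a, (u a * ρ (pderiv j (Q i a)) + v i a * ρ (pderiv j (P a))) -
      ∑ a, ((v i a + ρ (Q i a)) * ρ (pderiv j (P a)) + (u a + ρ (P a)) * ρ (pderiv j (Q i a))) +
      ∑ a, (ρ (P a) * ρ (pderiv j (Q i a)) + ρ (Q i a) * ρ (pderiv j (P a))) = 0 := by
    rw [← Finset.sum_sub_distrib, ← Finset.sum_add_distrib]
    exact Finset.sum_eq_zero fun a _ => by ring
  rw [← Finset.sum_add_distrib]
  linear_combination hs

-- The graph `u = -P`, `v = -Q` is sent to `u = v = 0`, and the correction `∑ (u + P)(v + Q)`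
-- vanishes on it.
omit [Fintype σ] [DecidableEq σ] [DecidableEq ι] in
theorem surjective_of_splitLift
    (hs : Function.Surjective (bind₁ fun i => X i - splitLift L P Q i)) :
    Function.Surjective (bind₁ fun i => X i - (L i + ∑ a, P a * Q i a)) := by
  let φ : MvPolynomial (σ ⊕ (ι ⊕ σ × ι)) ℂ →ₐ[ℂ] MvPolynomial σ ℂ :=
    aeval (Sum.elim X (Sum.elim (fun a => -P a) fun b => -Q b.1 b.2))
  let ψ : MvPolynomial (σ ⊕ (ι ⊕ σ × ι)) ℂ →ₐ[ℂ] MvPolynomial σ ℂ :=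
    aeval (Sum.elim X fun _ => 0)
  have hφ : ∀ p, φ (rename Sum.inl p) = p := fun p => by
    simp only [φ, aeval_rename]
    exact aeval_X_left_apply p
  refine surjective_bind₁_of_retract (φ := φ) (ψ := ψ) ?_
    (fun i => ⟨X (Sum.inl i), by simp [φ]⟩) hs
  rintro (i | a | ⟨k, a⟩)
  · simp only [splitLift, Sum.elim_inl, map_sub, map_mul, map_sum, map_add, hφ]
    simp only [φ, ψ, aeval_X, Sum.elim_inl, Sum.elim_inr, bind₁_X_right]
    have hs : ∑ a, (-P a * -Q i a + -P a * Q i a + -Q i a * P a) = -∑ a, P a * Q i a := by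
      rw [← Finset.sum_neg_distrib]
      exact Finset.sum_congr rfl fun a _ => by ring
    rw [hs, sub_neg_eq_add]
  · simp only [splitLift, Sum.elim_inr, Sum.elim_inl, map_sub, map_neg, hφ]
    simp [φ, ψ]
  · simp only [splitLift, Sum.elim_inr, map_sub, map_neg, hφ]
    simp [φ, ψ]

omit [Fintype σ] [DecidableEq σ] [DecidableEq ι] in
theorem orderAtLeast_splitLift (hL : ∀ i, OrderAtLeast 2 (L i)) (hP : ∀ a, OrderAtLeast 2 (P a))
    (hQ : ∀ i a, OrderAtLeast 2 (Q i a)) (i : σ ⊕ (ι ⊕ σ × ι)) :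
    OrderAtLeast 2 (splitLift L P Q i) := by
  have hX : ∀ j : σ ⊕ (ι ⊕ σ × ι),
      OrderAtLeast 1 (X j : MvPolynomial (σ ⊕ (ι ⊕ σ × ι)) ℂ) :=
    fun j => .of_isHomogeneous (isHomogeneous_X _ _)
  rcases i with i | a | b
  · refine (hL i).rename.sub (.sum _ fun a _ => ((OrderAtLeast.mul (hX _) (hX _)).add ?_).add ?_)
    · exact (OrderAtLeast.mul (hX _) (hQ i a).rename).mono (by norm_num)
    · exact (OrderAtLeast.mul (hX _) (hP a).rename).mono (by norm_num)
  · exact (hP a).rename.neg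
  · exact (hQ b.1 b.2).rename.neg

omit [Fintype σ] [DecidableEq σ] [DecidableEq ι] in
theorem totalDegree_splitLift {d : ℕ} (hd : 2 ≤ d) (hL : ∀ i, (L i).totalDegree ≤ d + 1)
    (hP : ∀ a, (P a).totalDegree ≤ d) (hQ : ∀ i a, (Q i a).totalDegree ≤ d)
    (i : σ ⊕ (ι ⊕ σ × ι)) : (splitLift L P Q i).totalDegree ≤ d + 1 := by
  have hX : ∀ j : σ ⊕ (ι ⊕ σ × ι),
      (X j : MvPolynomial (σ ⊕ (ι ⊕ σ × ι)) ℂ).totalDegree ≤ 1 :=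
    fun j => (isHomogeneous_X _ _).totalDegree_le
  rcases i with i | a | b
  · simp only [splitLift, Sum.elim_inl, ← mem_restrictTotalDegree]
    refine Submodule.sub_mem _ ?_ (Submodule.sum_mem _ fun a _ =>
      Submodule.add_mem _ (Submodule.add_mem _ ?_ ?_) ?_)
    all_goals rw [mem_restrictTotalDegree]
    · exact (totalDegree_rename_le _ _).trans (hL i)
    · exact (totalDegree_mul _ _).trans ((add_le_add (hX _) (hX _)).trans (by omega))
    · refine (totalDegree_mul _ _).trans ((add_le_add (hX _)
        ((totalDegree_rename_le _ _).trans (hQ i a))).trans (by omega))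
    · refine (totalDegree_mul _ _).trans ((add_le_add (hX _)
        ((totalDegree_rename_le _ _).trans (hP a))).trans (by omega))
  · simp only [splitLift, Sum.elim_inr, Sum.elim_inl, totalDegree_neg]
    exact ((totalDegree_rename_le _ _).trans (hP a)).trans (Nat.le_succ d)
  · simp only [splitLift, Sum.elim_inr, totalDegree_neg]
    exact ((totalDegree_rename_le _ _).trans (hQ b.1 b.2)).trans (Nat.le_succ d)

end DegreeReduction

/-! ### Induction on the degree and the remaining implications. -/

section Assembly

variable {σ : Type} [Fintype σ] [DecidableEq σ]

omit [Fintype σ] [DecidableEq σ] in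
theorem totalDegree_sub_homogeneousComponent {p : MvPolynomial σ ℂ} {d : ℕ}
    (hp : p.totalDegree ≤ d + 1) : (p - homogeneousComponent (d + 1) p).totalDegree ≤ d := by
  rw [MvPolynomial.totalDegree, Finset.sup_le_iff]
  intro m hm
  rw [mem_support_iff, coeff_sub, coeff_homogeneousComponent] at hm
  have h1 : m.degree ≠ d + 1 := fun h => hm (by rw [if_pos h, sub_self])
  rw [if_neg h1, sub_zero] at hm
  have h2 : m.degree ≤ p.totalDegree := le_totalDegree (mem_support_iff.2 hm)
  change m.degree ≤ d
  omega

omit [Fintype σ] [DecidableEq σ] in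
theorem orderAtLeast_sub_homogeneousComponent {p : MvPolynomial σ ℂ} {k d : ℕ}
    (hp : OrderAtLeast k p) : OrderAtLeast k (p - homogeneousComponent d p) := by
  refine hp.sub fun m hm => hp m fun h => hm ?_
  rw [coeff_homogeneousComponent, h, ite_self]

omit [Fintype σ] [DecidableEq σ] in
theorem eq_add_of_orderAtLeast_two {p : MvPolynomial σ ℂ} (ho : OrderAtLeast 2 p)
    (hd : p.totalDegree ≤ 3) :
    p = homogeneousComponent 2 p + homogeneousComponent 3 p := by
  ext m
  rw [coeff_add, coeff_homogeneousComponent, coeff_homogeneousComponent]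
  by_cases hm : coeff m p = 0
  · simp [hm]
  · have h1 := ho m hm
    have h2 : m.degree ≤ p.totalDegree := le_totalDegree (mem_support_iff.2 hm)
    obtain h | h : m.degree = 2 ∨ m.degree = 3 := by omega
    · simp [h]
    · simp [h]

-- Euler's identity applied twice. It supplies the products that `splitLift` splits.
omit [DecidableEq σ] in
theorem eq_sum_X_mul_X_mul_pderiv {p : MvPolynomial σ ℂ} {d : ℕ} (hp : p.IsHomogeneous (d + 2)) :
    p = ∑ a : σ × σ, X a.1 * X a.2 *
      (C (((d + 2) * (d + 1) : ℂ)⁻¹) * pderiv a.2 (pderiv a.1 p)) := by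
  have h1 : ∑ i, ∑ j, X i * X j * pderiv j (pderiv i p) = ((d + 2) * (d + 1) : ℂ) • p := by
    have h2 : ∀ i, ∑ j, X i * X j * pderiv j (pderiv i p) = (d + 1) • (X i * pderiv i p) :=
      fun i => by
        have := (hp.pderiv (i := i)).sum_X_mul_pderiv
        simp only [mul_assoc, ← Finset.mul_sum]
        rw [this, mul_smul_comm]
        rfl
    simp only [h2, ← Finset.smul_sum]
    rw [hp.sum_X_mul_pderiv, ← Nat.cast_smul_eq_nsmul ℂ, ← Nat.cast_smul_eq_nsmul ℂ, smul_smul]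
    push_cast
    ring_nf
  rw [Fintype.sum_prod_type]
  have h0 : ((d + 2) * (d + 1) : ℂ) ≠ 0 := by
    exact_mod_cast (by positivity : (d + 2) * (d + 1) ≠ 0)
  have h3 : ∀ i j : σ, X i * X j * (C (((d + 2) * (d + 1) : ℂ)⁻¹) * pderiv j (pderiv i p)) =
      ((d + 2) * (d + 1) : ℂ)⁻¹ • (X i * X j * pderiv j (pderiv i p)) := fun i j => by
    rw [smul_eq_C_mul]
    ring
  simp only [h3, ← Finset.smul_sum]
  rw [h1, smul_smul, inv_mul_cancel₀ h0, one_smul]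

theorem HomogeneousInversionPairConjecture.surjective_of_totalDegree
    (hI : HomogeneousInversionPairConjecture 4) (d : ℕ) :
    ∀ (σ : Type) [Fintype σ] [DecidableEq σ] (H : σ → MvPolynomial σ ℂ),
      (∀ i, OrderAtLeast 2 (H i)) → (∀ i, (H i).totalDegree ≤ d + 3) →
      (jac fun i => X i - H i).det = 1 → Function.Surjective (bind₁ fun i => X i - H i) := by
  induction d with
  | zero =>
    intro σ _ _ H ho hd hdet
    have hH : H = fun i => homogeneousComponent 2 (H i) + homogeneousComponent 3 (H i) :=
      funext fun i => eq_add_of_orderAtLeast_two (ho i) (hd i)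
    have h2 : ∀ i, (homogeneousComponent 2 (H i)).IsHomogeneous 2 := fun i =>
      homogeneousComponent_isHomogeneous _ _
    have h3 : ∀ i, (homogeneousComponent 3 (H i)).IsHomogeneous 3 := fun i =>
      homogeneousComponent_isHomogeneous _ _
    rw [hH] at hdet ⊢
    exact surjective_of_cubicLift (hI.surjective_cubic (isHomogeneous_cubicLift h2 h3)
      (det_jac_cubicLift h2 h3 hdet))
  | succ d ih =>
    intro σ _ _ H ho hd hdet
    let T : σ → MvPolynomial σ ℂ := fun i => homogeneousComponent (d + 4) (H i)
    -- Quadratic factors are used because each factor becomes a component of the new map and so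
    -- needs order at least 2. The cofactors have degree `d + 2`, so after multiplication by a new
    -- variable the degree is at most `d + 3`.
    let P : σ × σ → MvPolynomial σ ℂ := fun a => X a.1 * X a.2
    let Q : σ → σ × σ → MvPolynomial σ ℂ := fun i a =>
      C ((((d + 2 : ℕ) + 2) * ((d + 2 : ℕ) + 1) : ℂ)⁻¹) * pderiv a.2 (pderiv a.1 (T i))
    have hT : ∀ i, (T i).IsHomogeneous (d + 4) := fun i => homogeneousComponent_isHomogeneous _ _
    have hP : ∀ a, (P a).IsHomogeneous 2 := fun a => (isHomogeneous_X _ _).mul (isHomogeneous_X _ _)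
    have hQ : ∀ i a, (Q i a).IsHomogeneous (d + 2) := fun i a => (hT i).pderiv.pderiv.C_mul _
    have hH : H = fun i => (H i - T i) + ∑ a, P a * Q i a := funext fun i => by
      rw [← eq_sum_X_mul_X_mul_pderiv (hT i), sub_add_cancel]
    have hL2 : ∀ i, OrderAtLeast 2 (H i - T i) := fun i =>
      orderAtLeast_sub_homogeneousComponent (ho i)
    have hLd : ∀ i, (H i - T i).totalDegree ≤ d + 3 := fun i =>
      totalDegree_sub_homogeneousComponent (hd i)
    have hP2 : ∀ a, OrderAtLeast 2 (P a) := fun a => .of_isHomogeneous (hP a)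
    have hQ2 : ∀ i a, OrderAtLeast 2 (Q i a) := fun i a =>
      (OrderAtLeast.of_isHomogeneous (hQ i a)).mono (by omega)
    rw [hH] at hdet ⊢
    refine surjective_of_splitLift (ih _ _ (orderAtLeast_splitLift hL2 hP2 hQ2)
      (totalDegree_splitLift (by omega) hLd (fun a => (hP a).totalDegree_le.trans (by omega))
        fun i a => (hQ i a).totalDegree_le) ?_)
    rw [det_jac_splitLift, hdet, map_one]

theorem HomogeneousInversionPairConjecture.jacobianConjecture
    (hI : HomogeneousInversionPairConjecture 4) : JacobianConjecture := by
  intro n _ H ho hdet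
  refine exists_areInverse_of_surjective ?_
  let d := Finset.univ.sup fun i => (H i).totalDegree
  exact hI.surjective_of_totalDegree d (Fin n) H (fun i => le_polyOrder_iff.1 (ho i))
    (fun i => (Finset.le_sup (f := fun i => (H i).totalDegree) (Finset.mem_univ i)).trans
      (Nat.le_add_right _ _)) hdet

theorem two_le_polyOrder_of_isHomogeneous {n d : ℕ} {P : MvPolynomial (Fin n) ℂ} (hd : 2 ≤ d)
    (hP : P.IsHomogeneous d) : 2 ≤ polyOrder P :=
  le_polyOrder_iff (k := 2).2 ((OrderAtLeast.of_isHomogeneous hP).mono hd)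

theorem eventuallyVanishes_zero {n : ℕ} : EventuallyVanishes (0 : MvPolynomial (Fin n) ℂ) := by
  refine ⟨0, fun k _ => ?_⟩
  rw [zero_pow (Nat.succ_ne_zero k)]
  exact Function.iterate_fixed (by simp [laplacian]) k

theorem VanishingConjecture.homogeneous (h : VanishingConjecture) {d : ℕ} (hd : 2 ≤ d) :
    HomogeneousVanishingConjecture d := by
  intro n hn P hP hN
  -- Zero is homogeneous of every degree but has total degree 0, so the hypothesis does not cover
  -- it.
  by_cases h0 : P = 0
  · rw [h0]
    exact eventuallyVanishes_zero
  · exact h n hn P (hd.trans_eq (hP.totalDegree h0).symm) hN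

theorem InversionPairConjecture.homogeneous (h : InversionPairConjecture) {d : ℕ} (hd : 2 ≤ d) :
    HomogeneousInversionPairConjecture d := by
  intro n hn P hP hN
  have ho := two_le_polyOrder_of_isHomogeneous hd hP
  by_cases h0 : P = 0
  · refine hasPolynomialInversionPair_of_eventuallyVanishes hN ho ?_
    rw [h0]
    exact eventuallyVanishes_zero
  · exact h n hn P (hd.trans_eq (hP.totalDegree h0).symm) ho hN

theorem HomogeneousVanishingConjecture.inversionPair (h : HomogeneousVanishingConjecture 4) :
    HomogeneousInversionPairConjecture 4 := fun n hn P hP hN =>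
  hasPolynomialInversionPair_of_eventuallyVanishes hN
    (two_le_polyOrder_of_isHomogeneous (by norm_num) hP) (h n hn P hP hN)

end Assembly

end HNPoly

theorem theorem7p2 :
    List.TFAE [
      HNPoly.HomogeneousVanishingConjecture 4,
      ∀ d : ℕ, 2 ≤ d → HNPoly.HomogeneousVanishingConjecture d,
      HNPoly.VanishingConjecture,
      HNPoly.JacobianConjecture] ∧
    List.TFAE [
      HNPoly.HomogeneousInversionPairConjecture 4,
      ∀ d : ℕ, 2 ≤ d → HNPoly.HomogeneousInversionPairConjecture d,
      HNPoly.InversionPairConjecture,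
      HNPoly.JacobianConjecture] := by
  constructor
  · tfae_have 1 → 4 := fun h => h.inversionPair.jacobianConjecture
    tfae_have 4 → 3 := fun h n _ P _ hN => h.eventuallyVanishes hN
    tfae_have 3 → 2 := fun h d hd => h.homogeneous hd
    tfae_have 2 → 1 := fun h => h 4 (by norm_num)
    tfae_finish
  · tfae_have 1 → 4 := fun h => h.jacobianConjecture
    tfae_have 4 → 3 := fun h n _ P _ ho hN =>
      HNPoly.hasPolynomialInversionPair_of_eventuallyVanishes hN ho (h.eventuallyVanishes hN)
    tfae_have 3 → 2 := fun h d hd => h.homogeneous hd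
    tfae_have 2 → 1 := fun h => h 4 (by norm_num)
    tfae_finish
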